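/- Let $D$ be a digraph with $n\ge 1$ vertices and let $k\ge 0$ be an integer. An *out-tree* of $D$ is a subgraph $T$ of $D$ that is an oriented tree with exactly one vertex of in-degree zero, its *root*; its vertices of out-degree zero are its *leaves*, and the set of leaves is $\mathrm{Leaf}(T)$; the other vertices are *internal*. An out-tree is an *out-branching* if it is spanning. For an out-tree $T$ of $D$ and a set $L$ of vertices of $D$, none of which is an internal vertex of $T$, a *$(T,L)$-out-branching* is an out-branching of $D$ with the same root as $T$ that contains all arcs of $T$ and in which all vertices of $L$ are leaves; $\ell_{\max}(D,T,L)$ is the maximum number of leaves of a $(T,L)$-out-branching, and $0$ if there is none. Let $\hat D=\hat D(T,L)$ be obtained from $D$ by deleting all arcs out of vertices in $L$ and all arcs not in $A(T)$ that go into a vertex of $T$ (always taken with respect to the current $T$ and $L$). For a vertex $z$ of a digraph $H$, $N^+_H(z)$ is the set of its out-neighbours and $A^+_H(z)$ the set of arcs out of $z$; for a vertex $z$ of $T$, $T_z$ is the maximal subtree of $T$ with root $z$. For $x\in \mathrm{Leaf}(T)\setminus L$ let $T^{root}(x)$ be the out-tree with root $x$ that is formed by the arcs added in the following process: put $x':=x$;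 while $x'$ has exactly one out-neighbour $y$ in $\hat D$, add the arc $x'y$ to $T$ and put $x':=y$; finally add $A^+_{\hat D}(x')$ to $T$. Algorithm $\mathcal B(D,T,L)$ (with parameter $k$): 1. If $\ell_{\max}(D,T,L)=0$ (tested by checking whether every vertex can be reached from the root of $T$ in $\hat D$), return NO and stop. 2. While there is a vertex $x\in \mathrm{Leaf}(T)\setminus L$ with $\ell_{\max}(D,T,L\cup\{x\})=0$, add the arcs $A^+_{\hat D}(x)$ to $T$. 3. If $|L|\ge k$, return YES and stop. If $T$ has at least $k$ leaves, return YES and stop. If all leaves of $T$ belong to $L$, return NO and stop. 4. Choose a vertex $x\in \mathrm{Leaf}(T)\setminus L$ in a depth-first manner, colour $x$ red and let $H_x:=\hat D$. * (4.1) Let $z$ be the nearest proper ancestor of $x$ in $T$ that is coloured red, if it exists. * (4.2) Let $L':=L\cup\{x\}$. If $z$ exists and $T_z$ has exactly two leaves $x$ and $x'$, and $x'\in L$, then let $P=p_0p_1\dots p_r$ be a path in $H_z-A^+_{\hat D}(z)$ with $V(P)\setminus V(T_z)=\{p_0\}$ and $p_r\in N^+_{\hat D}(z)$, and let $L':=L\cup\{p_0,x\}$.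 * (4.3) $B_1:=\mathcal B(D,T,L')$ and $B_2:=$ NO. * (4.4) If $T^{root}(x)$ has at least two leaves, let $B_2:=\mathcal B(D,T\cup T^{root}(x),L)$. * (4.5) Return YES if $B_1$ or $B_2$ is YES, and NO otherwise. The colours and the digraphs $H_z$ are passed on to the recursive calls; in the initial call no vertex is coloured. "Depth-first" means: the leaves of $T$ are kept in a list in which, whenever arcs out of a leaf are added to $T$, the heads of these arcs take the place of that leaf, and $x$ is the first vertex of the list that is not in $L$. The remaining choices (the order of the vertices in Step 2, the order of the heads, the path $P$) are made by going through lists in a fixed order. The algorithm for Directed $k$-Leaf (decide whether $D$ has an out-branching with at least $k$ leaves) calls $\mathcal B(D,\{x\},\emptyset)$ for every vertex $x$ of $D$ and answers YES if one of the calls returns YES, and NO otherwise. **Theorem.** Algorithm $\mathcal B(D,T,L)$ runs in time $O(3.72^k n^{O(1)})$. That is, there are constants $C$ and $d$ such that for every $n\ge 1$, every digraph $D$ on $n$ vertices and every $k\ge 0$: for every out-tree $T$ of $D$ and every set $L$ of vertices of $D$ that contains no internal vertex of $T$, the call $\mathcal B(D,T,L)$ with parameter $k$ halts after at most $C\cdot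 3.72^k\, n^d$ elementary steps (comparing two vertices, inspecting or building one list cell, one look-up in the adjacency matrix of $D$; the subroutines are the obvious list programs built from such steps), and so does the algorithm for Directed $k$-Leaf. -/

import Mathlib

/-! ### Step-counted programs

A program carries a clock (a natural number) and may fail to halt (`none`).  Every function below
advances the clock by one each time it is entered; apart from calls to other such functions its
body does a bounded number of elementary operations (comparing two vertices, inspecting or
building one list cell, looking up one entry of the adjacency matrix; the list of all vertices
is part of the input).

Functions that are not recursive along a list take a bound `N` on the depth of the recursion as
an argument.  It has no effect on values and clocks: a computation that would exceed the
bound gives `none`, never an answer.  So the program halts with a value and a clock if and only if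
it returns them for some `N` (and then it returns the same for all larger `N`). -/

/-- Programs with a step counter: from the current clock, either fail to halt (`none`) or return a
value and the new clock. -/
abbrev Prog (α : Type) : Type := StateT ℕ Option α

/-- One step of computation. -/
def tick : Prog Unit := fun t => some ((), t + 1)

/-- A computation that exceeds the bound on the depth of the recursion. -/
def outOfDepth {α : Type} : Prog α := fun _ => none

/-- Keep the elements of a list that pass a test. -/
def filterP {α : Type} (p : α → Prog Bool) : List α → Prog (List α)
  | [] => do
    tick
    return []
  | a :: l => do
    tick
    let b ← p a
    let l' ← filterP p l
    return if b then a :: l' else l'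

/-- The first element of a list that passes a test, if there is one. -/
def findP {α : Type} (p : α → Prog Bool) : List α → Prog (Option α)
  | [] => do
    tick
    return none
  | a :: l => do
    tick
    let b ← p a
    if b then return some a else findP p l

/-- Apply a program to all elements of a list. -/
def mapP {α β : Type} (f : α → Prog β) : List α → Prog (List β)
  | [] => do
    tick
    return []
  | a :: l => do
    tick
    let b ← f a
    let l' ← mapP f l
    return b :: l'

/-- Concatenation of two lists. -/
def appendP {α : Type} : List α → List α → Prog (List α)
  | [], l₂ => do
    tick
    return l₂
  | a :: l₁, l₂ => do
    tick
    let l ← appendP l₁ l₂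
    return a :: l

/-- Is the length of the list at least `k`? -/
def lengthGeP {α : Type} : ℕ → List α → Prog Bool
  | 0, _ => do
    tick
    return true
  | _ + 1, [] => do
    tick
    return false
  | k + 1, _ :: l => do
    tick
    lengthGeP k l

/-- Is the vertex `v` in the list? -/
def memP {n : ℕ} (v : Fin n) : List (Fin n) → Prog Bool
  | [] => do
    tick
    return false
  | a :: l => do
    tick
    if a = v then return true else memP v l

/-- Is the arc `e` in the list? -/
def memArcP {n : ℕ} (e : Fin n × Fin n) : List (Fin n × Fin n) → Prog Bool
  | [] => do
    tick
    return false
  | a :: l => do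
    tick
    if a.1 = e.1 ∧ a.2 = e.2 then return true else memArcP e l

/-- `L ∪ {v}` for a set `L` stored as a list. -/
def insertP {n : ℕ} (v : Fin n) (L : List (Fin n)) : Prog (List (Fin n)) := do
  tick
  let b ← memP v L
  return if b then L else v :: L

/-- The out-neighbours of `x` in the digraph with the given arcs. -/
def outNbrsP {n : ℕ} (x : Fin n) : List (Fin n × Fin n) → Prog (List (Fin n))
  | [] => do
    tick
    return []
  | a :: l => do
    tick
    let Y ← outNbrsP x l
    return if a.1 = x then a.2 :: Y else Y

/-- The vertices that can be reached from the vertices in `S` along the given arcs: as long as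
some arc leads from `S` to a vertex outside `S`, that vertex is added to `S`. -/
def reachP {n : ℕ} (A : List (Fin n × Fin n)) : ℕ → List (Fin n) → Prog (List (Fin n))
  | 0, _ => outOfDepth
  | N + 1, S => do
    tick
    let e ← findP (fun a => do
      let b₁ ← memP a.1 S
      let b₂ ← memP a.2 S
      return b₁ && !b₂) A
    match e with
    | none => return S
    | some a => reachP A N (a.2 :: S)

/-! ### Out-trees -/

/-- The data by which an out-tree is stored: its root, its arcs, and its leaves.  The leaves are
listed in depth-first order: when arcs out of a leaf are added, their heads take the place of that
leaf in the list (see `addOutP`). -/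
structure OutTree (n : ℕ) where
  root : Fin n
  arcs : List (Fin n × Fin n)
  leaves : List (Fin n)

namespace OutTree

/-- The vertices of the out-tree: the root and all heads of arcs. -/
def verts {n : ℕ} (T : OutTree n) : List (Fin n) := T.root :: T.arcs.map Prod.snd

/-- The out-tree that consists of the vertex `x` only. -/
def single {n : ℕ} (x : Fin n) : OutTree n := ⟨x, [], [x]⟩

/-- `T` is an out-tree of `D`: its arcs are arcs of `D` between vertices of `T`, the root has
in-degree zero and every other vertex has in-degree one, every vertex can be reached from the root,
and `T.leaves` lists the vertices of out-degree zero. -/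
structure IsOutTree {n : ℕ} (D : Digraph (Fin n)) (T : OutTree n) : Prop where
  adj : ∀ a ∈ T.arcs, D.Adj a.1 a.2
  tail_mem : ∀ a ∈ T.arcs, a.1 ∈ T.verts
  nodup : T.verts.Nodup
  reach : ∀ v ∈ T.verts, Relation.ReflTransGen (fun u w => (u, w) ∈ T.arcs) T.root v
  leaves_nodup : T.leaves.Nodup
  mem_leaves : ∀ v, v ∈ T.leaves ↔ v ∈ T.verts ∧ ∀ a ∈ T.arcs, a.1 ≠ v

/-- `(D, T, L)` is a triple: `T` is an out-tree of `D`, and `L` is a set of vertices (stored as a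
list without repetitions) none of which is an internal vertex of `T`. -/
structure IsTriple {n : ℕ} (D : Digraph (Fin n)) (T : OutTree n) (L : List (Fin n)) : Prop where
  outTree : T.IsOutTree D
  nodup : L.Nodup
  not_internal : ∀ v ∈ L, v ∈ T.verts → v ∈ T.leaves

/-- `T'` is a `(T, L)`-out-branching of `D`: a spanning out-tree of `D` with the same root as `T`
that contains all arcs of `T` and in which all vertices of `L` are leaves. -/
structure IsOutBranching {n : ℕ} (D : Digraph (Fin n)) (T : OutTree n) (L : List (Fin n))
    (T' : OutTree n) : Prop where
  outTree : T'.IsOutTree D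
  root_eq : T'.root = T.root
  arcs_subset : T.arcs ⊆ T'.arcs
  leaf : L ⊆ T'.leaves
  spanning : ∀ v, v ∈ T'.verts

/-- The maximum number of leaves of a `(T, L)`-out-branching of `D`, and `0` if there is none. -/
noncomputable def maxLeaves {n : ℕ} (D : Digraph (Fin n)) (T : OutTree n) (L : List (Fin n)) : ℕ :=
  sSup {m | ∃ T', IsOutBranching D T L T' ∧ T'.leaves.length = m}

end OutTree

/-! ### The ingredients of the algorithm -/

/-- Is `v` a vertex of `T`? -/
def inTreeP {n : ℕ} (T : OutTree n) (v : Fin n) : Prog Bool := do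
  tick
  let H ← mapP (fun a => return a.2) T.arcs
  memP v (T.root :: H)

/-- Does the arc `uv` belong to the digraph `D̂(T, L)`, that is, is it an arc of `D`, not out of
a vertex in `L`, and, unless it is an arc of `T`, not into a vertex of `T`? -/
def inHatP {n : ℕ} (D : Digraph (Fin n)) [DecidableRel D.Adj] (T : OutTree n) (L : List (Fin n))
    (e : Fin n × Fin n) : Prog Bool := do
  tick
  if D.Adj e.1 e.2 then
    let b₁ ← memP e.1 L
    let b₂ ← memArcP e T.arcs
    let b₃ ← inTreeP T e.2
    return !b₁ && (b₂ || !b₃)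
  else return false

/-- All ordered pairs with first entry in the list and second entry any vertex. -/
def pairsP {n : ℕ} : List (Fin n) → Prog (List (Fin n × Fin n))
  | [] => do
    tick
    return []
  | u :: l => do
    tick
    let P ← mapP (fun v => return (u, v)) (List.finRange n)
    let R ← pairsP l
    appendP P R

/-- The list of arcs of `D̂(T, L)`. -/
def hatP {n : ℕ} (D : Digraph (Fin n)) [DecidableRel D.Adj] (T : OutTree n) (L : List (Fin n)) :
    Prog (List (Fin n × Fin n)) := do
  tick
  let P ← pairsP (List.finRange n)
  filterP (inHatP D T L) P

/-- Is there a `(T, L)`-out-branching of `D`?  Tested by asking whether all vertices can be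
reached from the root of `T` in `D̂(T, L)`; see `hasBranchingP_spec`. -/
def hasBranchingP {n : ℕ} (N : ℕ) (D : Digraph (Fin n)) [DecidableRel D.Adj] (T : OutTree n)
    (L : List (Fin n)) : Prog Bool := do
  tick
  let H ← hatP D T L
  let S ← reachP H N [T.root]
  let u ← findP (fun v => do
    let b ← memP v S
    return !b) (List.finRange n)
  return u.isNone

/-- Replace `x` by the list `Y` in a list of vertices. -/
def replaceP {n : ℕ} (x : Fin n) (Y : List (Fin n)) : List (Fin n) → Prog (List (Fin n))
  | [] => do
    tick
    return []
  | a :: l => do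
    tick
    if a = x then appendP Y l
    else
      let l' ← replaceP x Y l
      return a :: l'

/-- Add to `T` the arcs from its leaf `x` to the vertices in `Y`.  In the depth-first list of
leaves the vertices of `Y` take the place of `x` (if `Y` is empty, then `x` remains a leaf). -/
def addOutP {n : ℕ} (T : OutTree n) (x : Fin n) (Y : List (Fin n)) : Prog (OutTree n) := do
  tick
  match Y with
  | [] => return T
  | y :: Z =>
    let A ← mapP (fun v => return (x, v)) (y :: Z)
    let A' ← appendP A T.arcs
    let F ← replaceP x (y :: Z) T.leaves
    return ⟨T.root, A', F⟩

/-- Step (2): while there is a leaf `x` of `T` outside `L` such that there is no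
`(T, L ∪ {x})`-out-branching, add all arcs of `D̂(T, L)` out of `x` to `T`. -/
def forceP {n : ℕ} (D : Digraph (Fin n)) [DecidableRel D.Adj] (L : List (Fin n)) :
    ℕ → OutTree n → Prog (OutTree n)
  | 0, _ => outOfDepth
  | N + 1, T => do
    tick
    let c ← findP (fun x => do
      let b ← memP x L
      if b then return false
      else
        let b' ← hasBranchingP N D T (x :: L)
        return !b') T.leaves
    match c with
    | none => return T
    | some x =>
      let H ← hatP D T L
      let Y ← outNbrsP x H
      let T' ← addOutP T x Y
      forceP D L N T'

/-- The out-tree `T ∪ T^root(x)`, together with the list of leaves of `T^root(x)`: while the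
current vertex (at first `x`) has exactly one out-neighbour in `D̂(T, L)`, add the arc to it to `T`
and move to it; finally add all arcs of `D̂(T, L)` out of the current vertex. -/
def growTreeP {n : ℕ} (D : Digraph (Fin n)) [DecidableRel D.Adj] (L : List (Fin n)) :
    ℕ → OutTree n → Fin n → Prog (OutTree n × List (Fin n))
  | 0, _, _ => outOfDepth
  | N + 1, T, x => do
    tick
    let H ← hatP D T L
    let Y ← outNbrsP x H
    let T' ← addOutP T x Y
    match Y with
    | [] => return (T', [x])
    | [y] => growTreeP D L N T' y
    | y₁ :: y₂ :: Z => return (T', y₁ :: y₂ :: Z)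

/-- The vertices coloured red so far, each vertex `z` with the arcs of the digraph `H_z`. -/
abbrev RedList (n : ℕ) : Type := List (Fin n × List (Fin n × Fin n))

/-- Step (4.1): the nearest (proper) ancestor `z` of `x` in `T` that is coloured red, with `H_z`. -/
def nearestRedP {n : ℕ} (T : OutTree n) (red : RedList n) :
    ℕ → Fin n → Prog (Option (Fin n × List (Fin n × Fin n)))
  | 0, _ => outOfDepth
  | N + 1, x => do
    tick
    let e ← findP (fun a => do
      tick
      return decide (a.2 = x)) T.arcs
    match e with
    | none => return none
    | some a =>
      let r ← findP (fun z => do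
        tick
        return decide (z.1 = a.1)) red
      match r with
      | some z => return some z
      | none => nearestRedP T red N a.1

/-- The first vertex `p₀` of a path `P = p₀ p₁ … p_r` in `H_z - A⁺(z)` such that `p₀` is the only
vertex of `P` outside `T_z` and `p_r` is an out-neighbour of `z`.  Here `H` is the arc list of
`H_z`, `Z` lists the out-neighbours of `z` in the present `D̂(T, L)`, `A⁺(z)` is the set of arcs
from `z` to `Z`, and `S` lists the vertices of `T_z`. -/
def pathStartP {n : ℕ} (N : ℕ) (H : List (Fin n × Fin n)) (z : Fin n) (Z S : List (Fin n)) :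
    Prog (Option (Fin n)) := do
  tick
  let A ← filterP (fun a => do
    let b₁ ← memP a.2 S
    let b₂ ← memP a.2 Z
    return b₁ && !(decide (a.1 = z) && b₂)) H
  findP (fun p => do
    let b ← memP p S
    if b then return false
    else
      let R ← reachP A N [p]
      let q ← findP (fun v => memP v R) Z
      return q.isSome) (List.finRange n)

/-- Steps (4.1) and (4.2): the set `L'`, which is `L ∪ {p₀, x}` if the nearest red ancestor `z` of
`x` exists and `T_z` has exactly two leaves `x` and `x'` with `x'` in `L`, and `L ∪ {x}`
otherwise.  `Hat` is the arc list of `D̂(T, L)`. -/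
def newLeavesP {n : ℕ} (N : ℕ) (T : OutTree n) (L : List (Fin n)) (red : RedList n)
    (Hat : List (Fin n × Fin n)) (x : Fin n) : Prog (List (Fin n)) := do
  tick
  let L₁ ← insertP x L
  let r ← nearestRedP T red N x
  match r with
  | none => return L₁
  | some (z, H) =>
    let S ← reachP T.arcs N [z]
    let F ← filterP (fun v => memP v S) T.leaves
    let F' ← filterP (fun v => do
      tick
      return decide (v ≠ x)) F
    match F' with
    | [x'] =>
      let b ← memP x' L
      if b then
        let Z ← outNbrsP z Hat
        let p ← pathStartP N H z Z S
        match p with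
        | none => return L₁
        | some p₀ => insertP p₀ L₁
      else return L₁
    | _ => return L₁

/-- The branching algorithm `B(D, T, L)` with parameter `k`; `true` stands for YES.  The argument
`red` records the vertices coloured red on the way to the present call. -/
def algB {n : ℕ} (D : Digraph (Fin n)) [DecidableRel D.Adj] (k : ℕ) :
    ℕ → OutTree n → List (Fin n) → RedList n → Prog Bool
  | 0, _, _, _ => outOfDepth
  | N + 1, T, L, red => do
    tick
    -- Step (1)
    let b ← hasBranchingP N D T L
    if !b then return false
    else
      -- Step (2)
      let T₁ ← forceP D L N T
      -- Step (3)
      let c₁ ← lengthGeP k L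
      if c₁ then return true
      else
        let c₂ ← lengthGeP k T₁.leaves
        if c₂ then return true
        else
          let o ← findP (fun v => do
            let b ← memP v L
            return !b) T₁.leaves
          match o with
          | none => return false
          | some x =>
            -- Step (4): `x` is the first leaf outside `L` in depth-first order
            let H ← hatP D T₁ L
            -- Steps (4.1) and (4.2)
            let L' ← newLeavesP N T₁ L red H x
            -- Step (4.3)
            let B₁ ← algB D k N T₁ L' ((x, H) :: red)
            -- Step (4.4)
            let (T₂, Q) ← growTreeP D L N T₁ x
            let c₃ ← lengthGeP 2 Q
            if c₃ then
              let B₂ ← algB D k N T₂ L ((x, H) :: red)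
              -- Step (4.5)
              return B₁ || B₂
            else return B₁

/-- Run `B(D, {x}, ∅)` for every `x` in the list; YES if one of the answers is YES. -/
def rootsP {n : ℕ} (D : Digraph (Fin n)) [DecidableRel D.Adj] (k N : ℕ) :
    List (Fin n) → Prog Bool
  | [] => do
    tick
    return false
  | x :: l => do
    tick
    let b ← algB D k N (OutTree.single x) [] []
    let c ← rootsP D k N l
    return b || c

/-- The algorithm for Directed `k`-Leaf: run `B(D, {x}, ∅)` for every vertex `x` of `D`. -/
def directedKLeaf {n : ℕ} (D : Digraph (Fin n)) [DecidableRel D.Adj] (k N : ℕ) : Prog Bool := do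
  tick
  rootsP D k N (List.finRange n)

/-! ### Meaning of the test for `(T, L)`-out-branchings -/

/-- From every clock, the program halts with the value `a`. -/
def Returns {α : Type} (p : Prog α) (a : α) : Prop := ∀ s, ∃ t, p s = some (a, t)

theorem Returns.pure {α : Type} (a : α) : Returns (pure a : Prog α) a := fun s => ⟨s, rfl⟩

theorem Returns.bind {α β : Type} {p : Prog α} {f : α → Prog β} {a : α} {b : β}
    (hp : Returns p a) (hf : Returns (f a) b) : Returns (p >>= f) b := by
  intro s
  obtain ⟨t, ht⟩ := hp s
  obtain ⟨u, hu⟩ := hf t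
  refine ⟨u, ?_⟩
  change (p s).bind (fun x => f x.1 x.2) = _
  rw [ht]
  exact hu

theorem returns_tick : Returns tick () := fun s => ⟨s + 1, rfl⟩

theorem returns_filterP {α : Type} {p : α → Prog Bool} {q : α → Bool} (l : List α)
    (h : ∀ a ∈ l, Returns (p a) (q a)) : Returns (filterP p l) (l.filter q) := by
  induction l with
  | nil => exact returns_tick.bind (Returns.pure _)
  | cons a l ih =>
    refine returns_tick.bind ((h a (by simp)).bind
      ((ih fun b hb => h b (by simp [hb])).bind ?_))
    cases hq : q a <;> simp [hq] <;> exact Returns.pure _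

theorem returns_findP {α : Type} {p : α → Prog Bool} {q : α → Bool} (l : List α)
    (h : ∀ a ∈ l, Returns (p a) (q a)) : Returns (findP p l) (l.find? q) := by
  induction l with
  | nil => exact returns_tick.bind (Returns.pure _)
  | cons a l ih =>
    refine returns_tick.bind ((h a (by simp)).bind ?_)
    cases hq : q a
    · simpa [hq] using ih fun b hb => h b (by simp [hb])
    · simpa [hq] using Returns.pure _

theorem returns_mapP {α β : Type} {f : α → Prog β} {g : α → β} (l : List α)
    (h : ∀ a ∈ l, Returns (f a) (g a)) : Returns (mapP f l) (l.map g) := by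
  induction l with
  | nil => exact returns_tick.bind (Returns.pure _)
  | cons a l ih =>
    exact returns_tick.bind ((h a (by simp)).bind
      ((ih fun b hb => h b (by simp [hb])).bind (Returns.pure _)))

theorem returns_appendP {α : Type} (l₁ l₂ : List α) : Returns (appendP l₁ l₂) (l₁ ++ l₂) := by
  induction l₁ with
  | nil => exact returns_tick.bind (Returns.pure _)
  | cons a l ih => exact returns_tick.bind (ih.bind (Returns.pure _))

theorem returns_memP {n : ℕ} (v : Fin n) (l : List (Fin n)) :
    Returns (memP v l) (decide (v ∈ l)) := by
  induction l with
  | nil => exact returns_tick.bind (Returns.pure _)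
  | cons a l ih =>
    refine returns_tick.bind ?_
    by_cases h : a = v
    · simpa [h] using Returns.pure _
    · have h' : ¬ v = a := fun e => h e.symm
      simpa [h, h'] using ih

theorem returns_memArcP {n : ℕ} (e : Fin n × Fin n) (l : List (Fin n × Fin n)) :
    Returns (memArcP e l) (decide (e ∈ l)) := by
  induction l with
  | nil => exact returns_tick.bind (Returns.pure _)
  | cons a l ih =>
    refine returns_tick.bind ?_
    by_cases h : a = e
    · simpa [h] using Returns.pure _
    · have h' : ¬ e = a := fun e => h e.symm
      have h'' : ¬ (a.1 = e.1 ∧ a.2 = e.2) := fun ⟨h₁, h₂⟩ => h (Prod.ext h₁ h₂)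
      simpa [h', h''] using ih

theorem returns_pairsP {n : ℕ} (l : List (Fin n)) :
    Returns (pairsP l) (l.flatMap fun u => (List.finRange n).map fun v => (u, v)) := by
  induction l with
  | nil => exact returns_tick.bind (Returns.pure _)
  | cons a l ih =>
    exact returns_tick.bind ((returns_mapP _ fun v _ => Returns.pure (a, v)).bind
      (ih.bind (returns_appendP _ _)))

/-- The arcs of `D̂(T, L)`. -/
def HatArc {n : ℕ} (D : Digraph (Fin n)) (T : OutTree n) (L : List (Fin n))
    (u v : Fin n) : Prop :=
  D.Adj u v ∧ u ∉ L ∧ ((u, v) ∈ T.arcs ∨ v ∉ T.verts)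

theorem returns_inHatP {n : ℕ} (D : Digraph (Fin n)) [DecidableRel D.Adj] (T : OutTree n)
    (L : List (Fin n)) (e : Fin n × Fin n) :
    Returns (inHatP D T L e)
      (decide (D.Adj e.1 e.2) && (!decide (e.1 ∈ L) &&
        (decide (e ∈ T.arcs) || !decide (e.2 ∈ T.verts)))) := by
  refine returns_tick.bind ?_
  by_cases h : D.Adj e.1 e.2
  · rw [if_pos h, decide_eq_true h, Bool.true_and]
    refine (returns_memP _ _).bind ((returns_memArcP _ _).bind (Returns.bind ?_ (Returns.pure _)))
    exact returns_tick.bind ((returns_mapP _ fun a _ => Returns.pure a.2).bind (returns_memP _ _))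
  · rw [if_neg h, decide_eq_false h, Bool.false_and]
    exact Returns.pure _

theorem returns_hatP {n : ℕ} (D : Digraph (Fin n)) [DecidableRel D.Adj] (T : OutTree n)
    (L : List (Fin n)) :
    ∃ H, Returns (hatP D T L) H ∧ ∀ u v, (u, v) ∈ H ↔ HatArc D T L u v := by
  refine ⟨_, returns_tick.bind ((returns_pairsP _).bind
    (returns_filterP _ fun e _ => returns_inHatP D T L e)), fun u v => ?_⟩
  simp [HatArc]

theorem returns_reachP {n : ℕ} (A : List (Fin n × Fin n)) :
    ∀ (N : ℕ) (S : List (Fin n)), S.Nodup → n < N + S.length →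
      ∃ R, Returns (reachP A N S) R ∧
        ∀ v, v ∈ R ↔ ∃ u ∈ S, Relation.ReflTransGen (fun a b => (a, b) ∈ A) u v := by
  intro N
  induction N with
  | zero =>
    intro S hS h
    have := hS.length_le_card
    simp at this
    omega
  | succ N ih =>
    intro S hS h
    have hf := returns_findP (p := fun a : Fin n × Fin n => do
      let b₁ ← memP a.1 S
      let b₂ ← memP a.2 S
      return b₁ && !b₂) (q := fun a => decide (a.1 ∈ S) && !decide (a.2 ∈ S)) A
      (fun a _ => (returns_memP _ _).bind ((returns_memP _ _).bind (Returns.pure _)))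
    cases hq : A.find? (fun a => decide (a.1 ∈ S) && !decide (a.2 ∈ S)) with
    | none =>
      rw [hq] at hf
      refine ⟨S, returns_tick.bind (hf.bind (Returns.pure _)), fun v => ⟨fun hv => ⟨v, hv, .refl⟩, ?_⟩⟩
      rintro ⟨u, hu, huv⟩
      induction huv with
      | refl => exact hu
      | tail _ hbc ih' =>
        have := List.find?_eq_none.1 hq _ hbc
        simp at this
        exact this ih'
    | some a =>
      rw [hq] at hf
      have ha := List.find?_some hq
      have haA := List.mem_of_find?_eq_some hq
      simp at ha
      obtain ⟨R, hR, hm⟩ := ih (a.2 :: S) (List.nodup_cons.2 ⟨ha.2, hS⟩) (by simp; omega)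
      refine ⟨R, returns_tick.bind (hf.bind hR), fun v => (hm v).trans ⟨?_, ?_⟩⟩
      · rintro ⟨u, hu, huv⟩
        rcases List.mem_cons.1 hu with rfl | hu
        · exact ⟨a.1, ha.1, .head haA huv⟩
        · exact ⟨u, hu, huv⟩
      · rintro ⟨u, hu, huv⟩
        exact ⟨u, List.mem_cons_of_mem _ hu, huv⟩

namespace OutTree

/-- A `(T, L)`-out-branching uses arcs of `D̂(T, L)` only. -/
theorem IsOutBranching.hatArc {n : ℕ} {D : Digraph (Fin n)} {T T' : OutTree n}
    {L : List (Fin n)} (h : IsOutBranching D T L T') {u v : Fin n}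
    (huv : (u, v) ∈ T'.arcs) : HatArc D T L u v := by
  refine ⟨h.outTree.adj _ huv, fun hu => ?_, ?_⟩
  · exact ((h.outTree.mem_leaves u).1 (h.leaf hu)).2 _ huv rfl
  · by_contra hc
    push Not at hc
    obtain ⟨hc, hv⟩ := hc
    have hnd := List.nodup_cons.1 h.outTree.nodup
    rcases List.mem_cons.1 hv with hv | hv
    · exact hnd.1 (List.mem_map.2 ⟨_, huv, hv.trans h.root_eq.symm⟩)
    · obtain ⟨⟨w, v'⟩, hw, rfl⟩ := List.mem_map.1 hv
      have := List.inj_on_of_nodup_map hnd.2 (h.arcs_subset hw) huv rfl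
      exact hc (this ▸ hw)

/-- The leaves of an out-tree with given root and arcs. -/
def leavesOf {n : ℕ} (r : Fin n) (A : List (Fin n × Fin n)) : List (Fin n) :=
  (List.finRange n).filter fun v => decide (v ∈ r :: A.map Prod.snd ∧ ∀ a ∈ A, a.1 ≠ v)

theorem exists_outBranching {n : ℕ} {D : Digraph (Fin n)} {T : OutTree n} {L : List (Fin n)}
    (hT : T.IsOutTree D)
    (hr : ∀ v, Relation.ReflTransGen (HatArc D T L) T.root v) :
    ∃ T', IsOutBranching D T L T' := by
  have hroot : ∀ u, (u, T.root) ∉ T.arcs := fun u hu =>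
    (List.nodup_cons.1 hT.nodup).1 (List.mem_map.2 ⟨_, hu, rfl⟩)
  -- all arcs of `T` are arcs of `D̂(T, L)`
  have hTL : ∀ a ∈ T.arcs, a.1 ∉ L := by
    rintro ⟨u, v⟩ ha hu
    have hv : v ∈ T.verts := List.mem_cons_of_mem _ (List.mem_map.2 ⟨_, ha, rfl⟩)
    rcases Relation.ReflTransGen.cases_tail (hr v) with he | ⟨w, -, hw⟩
    · exact hroot u (he ▸ ha)
    · rcases hw.2.2 with hw' | hw'
      · have := List.inj_on_of_nodup_map (List.nodup_cons.1 hT.nodup).2 hw' ha rfl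
        simp only [Prod.mk.injEq, and_true] at this
        exact hw.2.1 (this ▸ hu)
      · exact hw' hv
  -- extend `T` arc by arc until it spans
  have key : ∀ (m : ℕ) (T₁ : OutTree n), T₁.IsOutTree D → T₁.root = T.root →
      T.arcs ⊆ T₁.arcs → (∀ a ∈ T₁.arcs, a.1 ∉ L) → n ≤ T₁.verts.length + m →
      ∃ T', IsOutBranching D T L T' := by
    intro m
    induction m with
    | zero =>
      intro T₁ h₁ hr₁ hs₁ hL₁ hm
      have hsp : ∀ v, v ∈ T₁.verts := by
        have hc : T₁.verts.toFinset = Finset.univ := by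
          apply Finset.eq_univ_of_card
          rw [List.toFinset_card_of_nodup h₁.nodup, Fintype.card_fin]
          exact le_antisymm (by simpa using h₁.nodup.length_le_card) (by simpa using hm)
        intro v
        have : v ∈ T₁.verts.toFinset := by rw [hc]; exact Finset.mem_univ v
        exact List.mem_toFinset.1 this
      exact ⟨T₁, h₁, hr₁, hs₁, fun v hv => (h₁.mem_leaves v).2
        ⟨hsp v, fun a ha hav => hL₁ a ha (hav ▸ hv)⟩, hsp⟩
    | succ m ih =>
      intro T₁ h₁ hr₁ hs₁ hL₁ hm
      by_cases hsp : ∀ v, v ∈ T₁.verts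
      · exact ⟨T₁, h₁, hr₁, hs₁, fun v hv => (h₁.mem_leaves v).2
          ⟨hsp v, fun a ha hav => hL₁ a ha (hav ▸ hv)⟩, hsp⟩
      · push Not at hsp
        obtain ⟨v, hv⟩ := hsp
        have hcross : ∃ a b, HatArc D T L a b ∧ a ∈ T₁.verts ∧ b ∉ T₁.verts := by
          by_contra hno
          push Not at hno
          refine hv ?_
          have := hr v
          induction this with
          | refl => rw [← hr₁]; exact List.mem_cons_self
          | tail _ hbc ih' =>
            by_contra hc
            exact hc (hno _ _ hbc (by by_contra hb; exact hb (ih' hb)))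
        obtain ⟨a, b, hab, ha, hb⟩ := hcross
        have hv' : ∀ w, w ∈ T₁.root :: ((a, b) :: T₁.arcs).map Prod.snd ↔
            w = b ∨ w ∈ T₁.verts := by
          intro w
          simp only [verts, List.map_cons, List.mem_cons]
          tauto
        refine ih ⟨T₁.root, (a, b) :: T₁.arcs, leavesOf T₁.root ((a, b) :: T₁.arcs)⟩
          ⟨?_, ?_, ?_, ?_, ?_, ?_⟩ hr₁ (fun e he => List.mem_cons_of_mem _ (hs₁ he)) ?_ ?_
        · intro e he
          rcases List.mem_cons.1 he with rfl | he
          · exact hab.1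
          · exact h₁.adj e he
        · intro e he
          refine (hv' _).2 (Or.inr ?_)
          rcases List.mem_cons.1 he with rfl | he
          · exact ha
          · exact h₁.tail_mem e he
        · have h1 := List.nodup_cons.1 h₁.nodup
          simp only [verts, List.mem_cons, not_or] at hb
          simp only [verts, List.map_cons, List.nodup_cons, List.mem_cons, not_or]
          exact ⟨⟨fun h => hb.1 h.symm, h1.1⟩, hb.2, h1.2⟩
        · have hold : ∀ w ∈ T₁.verts, Relation.ReflTransGen
              (fun u w => (u, w) ∈ (a, b) :: T₁.arcs) T₁.root w := fun w hw =>
            Relation.ReflTransGen.mono (fun _ _ h => List.mem_cons_of_mem _ h) _ _ (h₁.reach w hw)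
          intro w hw
          rcases (hv' w).1 hw with rfl | hw
          · exact (hold a ha).tail List.mem_cons_self
          · exact hold w hw
        · exact (List.nodup_finRange n).filter _
        · intro w
          simp [leavesOf, verts]
        · intro e he
          rcases List.mem_cons.1 he with rfl | he
          · exact hab.2.1
          · exact hL₁ e he
        · simp only [verts, List.length_cons, List.length_map] at hm ⊢
          omega
  exact key n T hT rfl (List.Subset.refl _) hTL (by omega)

theorem IsOutTree.leaves_ne_nil {n : ℕ} {D : Digraph (Fin n)} {T : OutTree n}
    (hT : T.IsOutTree D) : T.leaves ≠ [] := by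
  intro h
  have hsub : T.verts.toFinset ⊆ (T.arcs.map Prod.fst).toFinset := by
    intro v hv
    by_contra hc
    have : v ∈ T.leaves := (hT.mem_leaves v).2 ⟨List.mem_toFinset.1 hv, fun a ha hav =>
      hc (List.mem_toFinset.2 (List.mem_map.2 ⟨a, ha, hav⟩))⟩
    simp [h] at this
  have h1 := Finset.card_le_card hsub
  rw [List.toFinset_card_of_nodup hT.nodup] at h1
  have h2 := List.toFinset_card_le (T.arcs.map Prod.fst)
  simp [verts] at h1 h2
  omega

theorem maxLeaves_pos_iff {n : ℕ} (D : Digraph (Fin n)) (T : OutTree n) (L : List (Fin n)) :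
    0 < maxLeaves D T L ↔ ∃ T', IsOutBranching D T L T' := by
  constructor
  · intro h
    by_contra hc
    push Not at hc
    have : {m | ∃ T', IsOutBranching D T L T' ∧ T'.leaves.length = m} = ∅ := by
      ext m
      simp [hc]
    simp [maxLeaves, this] at h
  · rintro ⟨T', hT'⟩
    have hb : BddAbove {m | ∃ T', IsOutBranching D T L T' ∧ T'.leaves.length = m} := by
      refine ⟨n, ?_⟩
      rintro m ⟨T'', h, rfl⟩
      simpa using h.outTree.leaves_nodup.length_le_card
    exact lt_of_lt_of_le (List.length_pos_iff.2 hT'.outTree.leaves_ne_nil)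
      (le_csSup hb ⟨T', hT', rfl⟩)

end OutTree

/-- On every out-tree `T` of `D`, the test `hasBranchingP` decides whether the maximum number of
leaves of a `(T, L)`-out-branching is nonzero. -/
theorem hasBranchingP_spec {n N : ℕ} (hN : n < N) (D : Digraph (Fin n)) [DecidableRel D.Adj]
    {T : OutTree n} (hT : T.IsOutTree D) (L : List (Fin n)) :
    ∃ b, Returns (hasBranchingP N D T L) b ∧
      (b = false ↔ OutTree.maxLeaves D T L = 0) := by
  obtain ⟨H, hH, hHm⟩ := returns_hatP D T L
  obtain ⟨R, hR, hRm⟩ := returns_reachP H N [T.root] (by simp) (by omega)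
  refine ⟨_, returns_tick.bind (hH.bind (hR.bind ((returns_findP _
    (q := fun v => !decide (v ∈ R)) fun v _ =>
    (returns_memP v R).bind (Returns.pure _)).bind (Returns.pure _)))), ?_⟩
  have hHe : (fun a b => (a, b) ∈ H) = HatArc D T L := by
    funext a b
    exact propext (hHm a b)
  have hreach : ((List.finRange n).find? fun v => !decide (v ∈ R)).isNone = true ↔
      ∀ v, Relation.ReflTransGen (HatArc D T L) T.root v := by
    simp only [Option.isNone_iff_eq_none, List.find?_eq_none, List.mem_finRange, forall_const]
    refine forall_congr' fun v => ?_
    rw [← hHe]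
    simpa using hRm v
  rw [← not_iff_not, Bool.not_eq_false, hreach, ← ne_eq, ← Nat.pos_iff_ne_zero,
    OutTree.maxLeaves_pos_iff]
  constructor
  · exact OutTree.exists_outBranching hT
  · rintro ⟨T', h'⟩ v
    have := h'.outTree.reach v (h'.spanning v)
    rw [h'.root_eq] at this
    exact Relation.ReflTransGen.mono (fun _ _ h => h'.hatArc h) _ _ this

/-! ### Time bounds for step-counted programs -/

/-! Only the running time is at stake; correctness of the answers is never used. Outside its
recursive calls a call does at most `(n + 10) ^ 10` steps, and it makes at most two such calls. So
it suffices to find a measure `X`, at most `3.72 ^ k` at the start, with `X₁ + X₂ + 1 / 1000 ≤ X`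
for the measures of the two calls; `add_stepBound_le` turns this into a step bound, and
`algB_haltsIn` is the induction.

Write `c = 125 / 241`, so `c ^ (-2) = 3.717… < 3.72`. The naive measure is `c ^ (|L| + |Leaf(T)| -
2k)`. It is at least 1 when Step 4 is reached, because Step 3 has stopped all other calls. The first
call adds `x` to `L` and the second adds at least one leaf, so each multiplies the measure by at
most `c`; but `2c > 1`, and this alone would only give base 4. The gain comes from Step 4.2. Suppose
the second call at `z` has produced a subtree with exactly two leaves. When one of them lies in `L`
and the other is chosen, the first call there also puts `p₀` into `L`. This future saving is
credited in advance: while such a subtree comes next in depth-first order (`FocusAt`), the measure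
carries the factor `23 / 25` if both leaves are outside `L`, and `17 / 20` if exactly one is.

The vertex `p₀` exists (`FocusAt.exists_path`) because `z` was not forced in Step 2: every vertex
can be reached from the root in `H_z` without arcs out of `z`, and the last vertex outside `T_z` on
such a walk to a child of `z` serves. It is new in `L` (`FocusAt.not_mem_of_path`), because no
vertex of `L` outside `T_z` has an out-arc in `H_z`.

One leak remains. A vertex of `L` outside `T`, such as a former `p₀`, may enter `T` as one of the
two leaves, and an expected branching is then lost. Hence each vertex of `L` outside `T` carries a
factor `6 / 5`, which disappears on entry; `5 / 6 ≤ 17 / 20` covers the lost credit (`rate_mul_le`,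
`HasRate.expand`).

The second call then costs at most `c * 23 / 25` (`exists_hasRate_grown`). The first call fits into
the rest (`exists_hasRate_newLeaves`): without credit it needs `c + c * 23 / 25 < 1`, with two
active leaves `c * 17 / 20 + c * 23 / 25 < 23 / 25`, with one `c ^ 2 * 6 / 5 + c * 23 / 25 < 17 /
20`, each with a margin of at least `1 / 1000`. -/

/-- From every clock, the program halts within `c` steps with a value that satisfies `Q`. -/
def HaltsIn {α : Type} (p : Prog α) (c : ℕ) (Q : α → Prop) : Prop :=
  ∀ s, ∃ a t, p s = some (a, t) ∧ t ≤ s + c ∧ Q a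

namespace HaltsIn

variable {α β : Type}

theorem pure {a : α} {c : ℕ} {Q : α → Prop} (h : Q a) : HaltsIn (pure a : Prog α) c Q :=
  fun s => ⟨a, s, rfl, Nat.le_add_right _ _, h⟩

theorem bind {p : Prog α} {f : α → Prog β} {c d : ℕ} {Q : α → Prop} {R : β → Prop}
    (hp : HaltsIn p c Q) (hf : ∀ a, Q a → HaltsIn (f a) d R) : HaltsIn (p >>= f) (c + d) R := by
  intro s
  obtain ⟨a, t, ht, hts, ha⟩ := hp s
  obtain ⟨b, r, hr, hrt, hb⟩ := hf a ha t
  refine ⟨b, r, ?_, by omega, hb⟩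
  change (p s).bind (fun x => f x.1 x.2) = _
  rw [ht]
  exact hr

theorem mono {p : Prog α} {c d : ℕ} {Q R : α → Prop} (hp : HaltsIn p c Q) (hcd : c ≤ d)
    (hQR : ∀ a, Q a → R a) : HaltsIn p d R := fun s => by
  obtain ⟨a, t, ht, hts, ha⟩ := hp s
  exact ⟨a, t, ht, by omega, hQR a ha⟩

theorem le {p : Prog α} {c d : ℕ} {Q : α → Prop} (hp : HaltsIn p c Q) (hcd : c ≤ d) :
    HaltsIn p d Q := hp.mono hcd fun _ h => h

theorem tick_bind {f : Unit → Prog β} {d : ℕ} {R : β → Prop} (hf : HaltsIn (f ()) d R) :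
    HaltsIn (tick >>= f) (d + 1) R := by
  intro s
  obtain ⟨b, r, hr, hrt, hb⟩ := hf (s + 1)
  exact ⟨b, r, hr, by omega, hb⟩

/-- A value that is returned from every clock satisfies the postcondition. -/
theorem and_returns {p : Prog α} {c : ℕ} {Q : α → Prop} {a : α} (hp : HaltsIn p c Q)
    (ha : Returns p a) : HaltsIn p c (fun b => b = a ∧ Q b) := fun s => by
  obtain ⟨b, t, ht, hts, hb⟩ := hp s
  obtain ⟨r, hr⟩ := ha s
  rw [ht] at hr
  simp only [Option.some.injEq, Prod.mk.injEq] at hr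
  exact ⟨b, t, ht, hts, hr.1, hb⟩

end HaltsIn

/-! ### Running times of the list subroutines. -/

section ListPrograms

variable {α β : Type}

theorem filterP_haltsIn {p : α → Prog Bool} {q : α → Bool} {c : ℕ} (l : List α)
    (h : ∀ a ∈ l, HaltsIn (p a) c (· = q a)) :
    HaltsIn (filterP p l) (l.length * (c + 1) + 1) (· = l.filter q) := by
  induction l with
  | nil => exact HaltsIn.tick_bind (HaltsIn.pure rfl)
  | cons a l ih =>
    refine (HaltsIn.tick_bind ((h a (by simp)).bind fun b hb =>
      ((ih fun b hb => h b (by simp [hb])).bind (d := 0) (fun l' hl' => ?_)))).le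
      (by simp only [List.length_cons]; ring_nf; omega)
    subst hb hl'
    cases hq : q a <;> simp [hq] <;> exact HaltsIn.pure rfl

/-- The splitting of the list records that the hit is the first one. For the leaf chosen in Step 4
this says that all leaves before it lie in `L`. -/
theorem findP_haltsIn {p : α → Prog Bool} {q : α → Prop} {c : ℕ} (l : List α)
    (h : ∀ a ∈ l, HaltsIn (p a) c (fun b => b = true ↔ q a)) :
    HaltsIn (findP p l) (l.length * (c + 1) + 1) (fun o =>
      (o = none ∧ ∀ a ∈ l, ¬ q a) ∨
        ∃ a l₁ l₂, o = some a ∧ l = l₁ ++ a :: l₂ ∧ q a ∧ ∀ b ∈ l₁, ¬ q b) := by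
  induction l with
  | nil => exact HaltsIn.tick_bind (HaltsIn.pure (by simp))
  | cons a l ih =>
    refine (HaltsIn.tick_bind ((h a (by simp)).bind (d := l.length * (c + 1) + 1)
      fun b hb => ?_)).le (by simp only [List.length_cons]; ring_nf; omega)
    cases b
    · refine (ih fun b hb => h b (by simp [hb])).mono le_rfl ?_
      have hqa : ¬ q a := by simpa using hb
      rintro o (⟨rfl, ho⟩ | ⟨x, l₁, l₂, rfl, rfl, hx, hl₁⟩)
      · exact Or.inl ⟨rfl, by simpa [hqa] using ho⟩
      · exact Or.inr ⟨x, a :: l₁, l₂, rfl, rfl, hx, by simpa [hqa] using hl₁⟩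
    · exact HaltsIn.pure (Or.inr ⟨a, [], l, rfl, rfl, by simpa using hb, by simp⟩)

theorem mapP_haltsIn {f : α → Prog β} {g : α → β} {c : ℕ} (l : List α)
    (h : ∀ a ∈ l, HaltsIn (f a) c (· = g a)) :
    HaltsIn (mapP f l) (l.length * (c + 1) + 1) (· = l.map g) := by
  induction l with
  | nil => exact HaltsIn.tick_bind (HaltsIn.pure rfl)
  | cons a l ih =>
    refine (HaltsIn.tick_bind ((h a (by simp)).bind fun b hb =>
      ((ih fun b hb => h b (by simp [hb])).bind (d := 0) (fun l' hl' => ?_)))).le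
      (by simp only [List.length_cons]; ring_nf; omega)
    subst hb hl'
    exact HaltsIn.pure rfl

theorem appendP_haltsIn (l₁ l₂ : List α) :
    HaltsIn (appendP l₁ l₂) (l₁.length + 1) (· = l₁ ++ l₂) := by
  induction l₁ with
  | nil => exact HaltsIn.tick_bind (HaltsIn.pure rfl)
  | cons a l ih =>
    exact HaltsIn.tick_bind (ih.bind (d := 0) fun b hb => HaltsIn.pure (by simp [hb]))

theorem lengthGeP_haltsIn (k : ℕ) (l : List α) :
    HaltsIn (lengthGeP k l) (min k l.length + 1) (fun b => b = true ↔ k ≤ l.length) := by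
  induction l generalizing k with
  | nil =>
    cases k with
    | zero => exact HaltsIn.tick_bind (HaltsIn.pure (by simp))
    | succ k => exact HaltsIn.tick_bind (HaltsIn.pure (by simp))
  | cons a l ih =>
    cases k with
    | zero => exact HaltsIn.tick_bind (HaltsIn.pure (by simp))
    | succ k =>
      refine (HaltsIn.tick_bind ((ih k).mono le_rfl fun b hb => by simpa using hb)).le ?_
      simp only [List.length_cons]
      omega

variable {n : ℕ}

theorem memP_haltsIn (v : Fin n) (l : List (Fin n)) :
    HaltsIn (memP v l) (l.length + 1) (fun b => b = true ↔ v ∈ l) := by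
  induction l with
  | nil => exact HaltsIn.tick_bind (HaltsIn.pure (by simp))
  | cons a l ih =>
    refine HaltsIn.tick_bind (d := l.length + 1) ?_
    by_cases h : a = v
    · rw [if_pos h]
      exact HaltsIn.pure (by simp [h])
    · rw [if_neg h]
      exact ih.mono le_rfl fun b hb => by
        have h' : ¬ v = a := fun e => h e.symm
        simpa [h'] using hb

theorem memArcP_haltsIn (e : Fin n × Fin n) (l : List (Fin n × Fin n)) :
    HaltsIn (memArcP e l) (l.length + 1) (fun b => b = true ↔ e ∈ l) := by
  induction l with
  | nil => exact HaltsIn.tick_bind (HaltsIn.pure (by simp))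
  | cons a l ih =>
    refine HaltsIn.tick_bind (d := l.length + 1) ?_
    by_cases h : a.1 = e.1 ∧ a.2 = e.2
    · rw [if_pos h]
      exact HaltsIn.pure (by simp [Prod.ext h.1 h.2])
    · rw [if_neg h]
      exact ih.mono le_rfl fun b hb => by
        have h' : ¬ e = a := by rintro rfl; exact h ⟨rfl, rfl⟩
        simpa [h'] using hb

theorem insertP_haltsIn (v : Fin n) (L : List (Fin n)) :
    HaltsIn (insertP v L) (L.length + 2) (· = if v ∈ L then L else v :: L) := by
  refine HaltsIn.tick_bind ((memP_haltsIn v L).bind (d := 0) fun b hb => HaltsIn.pure ?_)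
  cases b <;> simp_all

theorem outNbrsP_haltsIn (x : Fin n) (l : List (Fin n × Fin n)) :
    HaltsIn (outNbrsP x l) (l.length + 1)
      (· = (l.filter fun a => decide (a.1 = x)).map Prod.snd) := by
  induction l with
  | nil => exact HaltsIn.tick_bind (HaltsIn.pure rfl)
  | cons a l ih =>
    refine HaltsIn.tick_bind (ih.bind (d := 0) fun Y hY => HaltsIn.pure ?_)
    by_cases h : a.1 = x <;> simp [h, hY]

theorem pairsP_haltsIn (l : List (Fin n)) :
    HaltsIn (pairsP l) (l.length * (2 * n + 3) + 1)
      (· = l.flatMap fun u => (List.finRange n).map fun v => (u, v)) := by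
  induction l with
  | nil => exact HaltsIn.tick_bind (HaltsIn.pure rfl)
  | cons a l ih =>
    refine (HaltsIn.tick_bind ((mapP_haltsIn (List.finRange n) (c := 0) (g := fun v => (a, v))
      fun v _ => HaltsIn.pure rfl).bind fun P hP => ih.bind (d := n + 1) fun R hR => ?_)).le ?_
    · exact (appendP_haltsIn _ _).mono (by simp [hP]) fun b hb => by
        rw [hb, hP, hR, List.flatMap_cons]
    · simp only [List.length_cons, List.length_finRange]
      ring_nf
      omega

theorem flatMap_replace_eq {x : Fin n} {Y l : List (Fin n)} (h : x ∉ l) :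
    (l.flatMap fun a => if a = x then Y else [a]) = l := by
  induction l with
  | nil => rfl
  | cons a l ih =>
    simp only [List.mem_cons, not_or] at h
    rw [List.flatMap_cons, if_neg (Ne.symm h.1), ih h.2, List.singleton_append]

/-- The program stops at the first occurrence of `x` while the `flatMap` replaces all of them;
without repetitions the two agree. -/
theorem replaceP_haltsIn (x : Fin n) (Y : List (Fin n)) {l : List (Fin n)} (hl : l.Nodup) :
    HaltsIn (replaceP x Y l) (l.length + Y.length + 2)
      (· = l.flatMap fun a => if a = x then Y else [a]) := by
  induction l with
  | nil => exact HaltsIn.tick_bind (HaltsIn.pure rfl)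
  | cons a l ih =>
    have hl' := List.nodup_cons.1 hl
    refine (HaltsIn.tick_bind (d := l.length + Y.length + 2) ?_).le
      (by simp only [List.length_cons]; omega)
    by_cases h : a = x
    · rw [if_pos h]
      refine (appendP_haltsIn _ _).mono (by omega) fun b hb => ?_
      subst h
      simp [hb, flatMap_replace_eq hl'.1]
    · rw [if_neg h]
      exact ((ih hl'.2).bind (d := 0) fun b hb => HaltsIn.pure (by simp [h, hb])).le (by omega)

/-- The set of vertices reachable from `S` is computed in at most `n + 1` passes over the arcs. -/
theorem reachP_haltsIn (A : List (Fin n × Fin n)) (N : ℕ) (S : List (Fin n)) (hS : S.Nodup)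
    (h : n < N + S.length) :
    HaltsIn (reachP A N S)
      ((n + 1 - S.length) * (A.length * (2 * n + 3) + 2)) fun R =>
        R.Nodup ∧ ∀ v, v ∈ R ↔ ∃ u ∈ S, Relation.ReflTransGen (fun a b => (a, b) ∈ A) u v := by
  obtain ⟨R, hR, hRm⟩ := returns_reachP A N S hS h
  -- The value is already known from `returns_reachP`, so only the time and the absence of
  -- repetitions need the induction.
  suffices HaltsIn (reachP A N S) ((n + 1 - S.length) * (A.length * (2 * n + 3) + 2))
      (fun R => R.Nodup) from
    (this.and_returns hR).mono le_rfl fun b hb => ⟨hb.2, hb.1 ▸ hRm⟩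
  clear hRm hR R
  induction N generalizing S with
  | zero =>
    have := hS.length_le_card
    simp at this
    omega
  | succ N ih =>
    have hSn : S.length ≤ n := by simpa using hS.length_le_card
    obtain ⟨m, hm⟩ : ∃ m, n + 1 - S.length = m + 1 := ⟨n - S.length, by omega⟩
    refine (HaltsIn.tick_bind ((findP_haltsIn (c := 2 * n + 2)
      (q := fun a => a.1 ∈ S ∧ a.2 ∉ S) A (fun a _ => ?_)).bind
      (d := m * (A.length * (2 * n + 3) + 2)) fun o ho => ?_)).le ?_
    · refine ((memP_haltsIn a.1 S).bind fun b hb => (memP_haltsIn a.2 S).bind (d := 0)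
        fun b' hb' => HaltsIn.pure ?_).le (by omega)
      simp [hb, ← hb']
    · rcases ho with ⟨rfl, -⟩ | ⟨a, l₁, l₂, rfl, -, ha, -⟩
      · exact HaltsIn.pure hS
      · refine (ih (a.2 :: S) (List.nodup_cons.2 ⟨ha.2, hS⟩) (by simp; omega)).le ?_
        apply Nat.mul_le_mul_right
        simp only [List.length_cons]
        omega
    · rw [hm]
      ring_nf
      omega

end ListPrograms

/-! ### Expanding a leaf of an out-tree -/

namespace OutTree

variable {n : ℕ}

/-- `v` is a descendant of `u` in `T` (every vertex is a descendant of itself). -/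
def Desc (T : OutTree n) (u v : Fin n) : Prop :=
  Relation.ReflTransGen (fun a b => (a, b) ∈ T.arcs) u v

/-- Every vertex can be reached in `D̂(T, L)` from the root of `T`. -/
def Spans (D : Digraph (Fin n)) (T : OutTree n) (L : List (Fin n)) : Prop :=
  ∀ v, Relation.ReflTransGen (HatArc D T L) T.root v

/-- The out-tree `T` together with the arcs from its leaf `x` to the vertices of `Y`. -/
def expand (T : OutTree n) (x : Fin n) (Y : List (Fin n)) : OutTree n :=
  ⟨T.root, Y.map (fun v => (x, v)) ++ T.arcs, T.leaves.flatMap fun a => if a = x then Y else [a]⟩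

/-- The vertices of `Y` are the out-neighbours in `D̂(T, L)` of the leaf `x`, and there is one. -/
structure CanExpand (D : Digraph (Fin n)) (L : List (Fin n)) (T : OutTree n) (x : Fin n)
    (Y : List (Fin n)) : Prop where
  mem_leaves : x ∈ T.leaves
  ne_nil : Y ≠ []
  nodup : Y.Nodup
  mem_iff : ∀ v, v ∈ Y ↔ HatArc D T L x v

/-- `T'` arises from `T` by adding all arcs of `D̂(T, L)` out of some leaf. -/
def Expands (D : Digraph (Fin n)) (L : List (Fin n)) (T T' : OutTree n) : Prop :=
  ∃ x Y, CanExpand D L T x Y ∧ T' = T.expand x Y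

namespace IsOutTree

variable {D : Digraph (Fin n)} {T : OutTree n}

theorem length_arcs_lt (hT : T.IsOutTree D) : T.arcs.length < n := by
  have := hT.nodup.length_le_card
  simp [verts] at this
  omega

theorem length_leaves_le (hT : T.IsOutTree D) : T.leaves.length ≤ n := by
  simpa using hT.leaves_nodup.length_le_card

theorem head_mem (_hT : T.IsOutTree D) {u v : Fin n} (h : (u, v) ∈ T.arcs) : v ∈ T.verts :=
  List.mem_cons_of_mem _ (List.mem_map.2 ⟨_, h, rfl⟩)

theorem root_not_head (hT : T.IsOutTree D) (u : Fin n) : (u, T.root) ∉ T.arcs := fun hu =>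
  (List.nodup_cons.1 hT.nodup).1 (List.mem_map.2 ⟨_, hu, rfl⟩)

theorem parent_unique (hT : T.IsOutTree D) {u w v : Fin n} (hu : (u, v) ∈ T.arcs)
    (hw : (w, v) ∈ T.arcs) : u = w := by
  have := List.inj_on_of_nodup_map (List.nodup_cons.1 hT.nodup).2 hu hw rfl
  simpa using this

theorem leaf_mem (hT : T.IsOutTree D) {x : Fin n} (hx : x ∈ T.leaves) : x ∈ T.verts :=
  ((hT.mem_leaves x).1 hx).1

theorem leaf_not_tail (hT : T.IsOutTree D) {x v : Fin n} (hx : x ∈ T.leaves) :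
    (x, v) ∉ T.arcs := fun h => ((hT.mem_leaves x).1 hx).2 _ h rfl

/-- Induction along the path from the root: a cycle through a vertex enters it by its unique in-arc,
so it also passes through the parent. The root has no in-arc. -/
theorem acyclic (hT : T.IsOutTree D) {v : Fin n} (hv : v ∈ T.verts) :
    ¬ Relation.TransGen (fun a b => (a, b) ∈ T.arcs) v v := by
  have := hT.reach v hv
  clear hv
  induction this with
  | refl =>
    intro h
    obtain ⟨w, -, hw⟩ := Relation.TransGen.tail'_iff.1 h
    exact hT.root_not_head _ hw
  | tail _ hbc ih =>
    intro h
    obtain ⟨w, hw, hwc⟩ := Relation.TransGen.tail'_iff.1 h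
    obtain rfl := hT.parent_unique hbc hwc
    exact ih (Relation.TransGen.head' hbc hw)

theorem desc_leaf (hT : T.IsOutTree D) {x v : Fin n} (hx : x ∈ T.leaves) (h : T.Desc x v) :
    v = x := by
  rcases Relation.ReflTransGen.cases_head h with h | ⟨w, hw, -⟩
  · exact h.symm
  · exact absurd hw (hT.leaf_not_tail hx)

end IsOutTree

theorem mem_verts_expand {T : OutTree n} {x v : Fin n} {Y : List (Fin n)} :
    v ∈ (T.expand x Y).verts ↔ v ∈ Y ∨ v ∈ T.verts := by
  simp only [expand, verts, List.map_append, List.map_map, List.mem_cons, List.mem_append,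
    List.mem_map, Function.comp_apply, exists_eq_right]
  tauto

theorem mem_arcs_expand {T : OutTree n} {x u v : Fin n} {Y : List (Fin n)} :
    (u, v) ∈ (T.expand x Y).arcs ↔ (u = x ∧ v ∈ Y) ∨ (u, v) ∈ T.arcs := by
  simp only [expand, List.mem_append, List.mem_map, Prod.mk.injEq]
  constructor
  · rintro (⟨w, hw, rfl, rfl⟩ | h)
    · exact Or.inl ⟨rfl, hw⟩
    · exact Or.inr h
  · rintro (⟨rfl, h⟩ | h)
    · exact Or.inl ⟨v, h, rfl, rfl⟩
    · exact Or.inr h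

theorem leaves_expand {T : OutTree n} {x : Fin n} {Y pre post : List (Fin n)}
    (h : T.leaves = pre ++ x :: post) (hn : T.leaves.Nodup) :
    (T.expand x Y).leaves = pre ++ Y ++ post := by
  rw [h, List.nodup_middle, List.nodup_cons, List.mem_append, not_or] at hn
  simp [expand, h, flatMap_replace_eq hn.1.1, flatMap_replace_eq hn.1.2]

namespace CanExpand

variable {D : Digraph (Fin n)} {L : List (Fin n)} {T : OutTree n} {x : Fin n} {Y : List (Fin n)}

theorem not_mem_left (h : CanExpand D L T x Y) : x ∉ L := by
  obtain ⟨y, hy⟩ := List.exists_mem_of_ne_nil _ h.ne_nil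
  exact ((h.mem_iff y).1 hy).2.1

theorem adj (h : CanExpand D L T x Y) {v : Fin n} (hv : v ∈ Y) : D.Adj x v :=
  ((h.mem_iff v).1 hv).1

theorem not_mem_verts (h : CanExpand D L T x Y) (hT : T.IsOutTree D) {v : Fin n} (hv : v ∈ Y) :
    v ∉ T.verts :=
  ((h.mem_iff v).1 hv).2.2.resolve_left (hT.leaf_not_tail h.mem_leaves)

theorem adj_mem_verts (h : CanExpand D L T x Y) {v : Fin n} (hv : D.Adj x v) :
    v ∈ (T.expand x Y).verts := by
  rw [mem_verts_expand]
  by_cases hvT : v ∈ T.verts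
  · exact Or.inr hvT
  · exact Or.inl ((h.mem_iff v).2 ⟨hv, h.not_mem_left, Or.inr hvT⟩)

/-- The vertices of `Y` are new, so no arc leaves them: a descending path uses at most one new arc,
and only as its last arc. -/
theorem desc_expand (h : CanExpand D L T x Y) (hT : T.IsOutTree D) {z v : Fin n}
    (hz : z ∈ T.verts) :
    (T.expand x Y).Desc z v ↔ (v ∈ T.verts ∧ T.Desc z v) ∨ (v ∈ Y ∧ T.Desc z x) := by
  constructor
  · intro hd
    induction hd with
    | refl => exact Or.inl ⟨hz, .refl⟩
    | tail _ hbc ih =>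
      rcases mem_arcs_expand.1 hbc with ⟨rfl, hY⟩ | hA
      · rcases ih with ⟨-, hb⟩ | ⟨-, hb⟩ <;> exact Or.inr ⟨hY, hb⟩
      · rcases ih with ⟨-, hb⟩ | ⟨hb, -⟩
        · exact Or.inl ⟨hT.head_mem hA, hb.tail hA⟩
        · exact absurd (hT.tail_mem _ hA) (h.not_mem_verts hT hb)
  · have hmono : ∀ v, T.Desc z v → (T.expand x Y).Desc z v := fun v hv =>
      Relation.ReflTransGen.mono (fun _ _ h => mem_arcs_expand.2 (Or.inr h)) _ _ hv
    rintro (⟨-, hv⟩ | ⟨hv, hx⟩)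
    · exact hmono v hv
    · exact (hmono x hx).tail (mem_arcs_expand.2 (Or.inl ⟨rfl, hv⟩))

theorem exists_leaves_eq (h : CanExpand D L T x Y) :
    ∃ pre post, T.leaves = pre ++ x :: post := List.append_of_mem h.mem_leaves

theorem isOutTree (h : CanExpand D L T x Y) (hT : T.IsOutTree D) :
    (T.expand x Y).IsOutTree D := by
  obtain ⟨pre, post, hl⟩ := h.exists_leaves_eq
  have hle := leaves_expand (Y := Y) hl hT.leaves_nodup
  have hxT := hT.leaf_mem h.mem_leaves
  have hnd := hT.leaves_nodup
  rw [hl, List.nodup_middle, List.nodup_cons] at hnd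
  refine ⟨?_, ?_, ?_, ?_, ?_, ?_⟩
  · rintro ⟨u, v⟩ ha
    rcases mem_arcs_expand.1 ha with ⟨rfl, hv⟩ | ha
    · exact h.adj hv
    · exact hT.adj _ ha
  · rintro ⟨u, v⟩ ha
    rw [mem_verts_expand]
    rcases mem_arcs_expand.1 ha with ⟨rfl, hv⟩ | ha
    · exact Or.inr hxT
    · exact Or.inr (hT.tail_mem _ ha)
  · have : (T.expand x Y).verts.Perm (Y ++ T.verts) := by
      simp only [expand, verts, List.map_append, List.map_map]
      have : (Prod.snd ∘ fun v => (x, v)) = (id : Fin n → Fin n) := rfl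
      rw [this, List.map_id]
      exact List.perm_middle.symm
    rw [this.nodup_iff, List.nodup_append']
    exact ⟨h.nodup, hT.nodup, fun v hv => h.not_mem_verts hT hv⟩
  · intro v hv
    have hroot : T.root ∈ T.verts := List.mem_cons_self
    refine (h.desc_expand hT hroot).2 ?_
    rcases mem_verts_expand.1 hv with hv | hv
    · exact Or.inr ⟨hv, hT.reach x hxT⟩
    · exact Or.inl ⟨hv, hT.reach v hv⟩
  · rw [hle]
    have : (pre ++ Y ++ post).Perm (Y ++ (pre ++ post)) := by
      rw [List.append_assoc]
      exact List.perm_append_comm_assoc _ _ _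
    rw [this.nodup_iff, List.nodup_append']
    refine ⟨h.nodup, hnd.2, fun v hv hv' => h.not_mem_verts hT hv (hT.leaf_mem ?_)⟩
    rw [hl]
    simp only [List.mem_append, List.mem_cons] at hv' ⊢
    tauto
  · intro v
    rw [hle, mem_verts_expand]
    have hv : v ∈ pre ++ Y ++ post ↔ v ∈ Y ∨ (v ∈ T.leaves ∧ v ≠ x) := by
      rw [hl]
      have : v ∈ pre ++ post → v ≠ x := fun hv hvx => hnd.1 (hvx ▸ hv)
      simp only [List.mem_append, List.mem_cons] at this ⊢
      tauto
    rw [hv]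
    clear hv
    constructor
    · rintro (hv | ⟨hv, hvx⟩)
      · refine ⟨Or.inl hv, ?_⟩
        rintro ⟨a, b⟩ ha rfl
        rcases mem_arcs_expand.1 ha with ⟨rfl, -⟩ | ha
        · exact h.not_mem_verts hT hv hxT
        · exact h.not_mem_verts hT hv (hT.tail_mem _ ha)
      · refine ⟨Or.inr (hT.leaf_mem hv), ?_⟩
        rintro ⟨a, b⟩ ha rfl
        rcases mem_arcs_expand.1 ha with ⟨rfl, -⟩ | ha
        · exact hvx rfl
        · exact hT.leaf_not_tail hv ha
    · rintro ⟨hv, ha⟩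
      rcases hv with hv | hv
      · exact Or.inl hv
      · refine Or.inr ⟨(hT.mem_leaves v).2 ⟨hv, fun a haT =>
          ha a (List.mem_append_right _ haT)⟩, ?_⟩
        rintro rfl
        obtain ⟨y, hy⟩ := List.exists_mem_of_ne_nil _ h.ne_nil
        exact ha (v, y) (mem_arcs_expand.2 (Or.inl ⟨rfl, hy⟩)) rfl

end CanExpand

namespace Spans

variable {D : Digraph (Fin n)} {L : List (Fin n)} {T : OutTree n}

/-- The head `v` can be entered in `D̂(T, L)` only by its tree arc, which therefore survives the
deletion of the arcs out of `L`. -/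
theorem tail_not_mem (h : Spans D T L) (hT : T.IsOutTree D) {u v : Fin n}
    (ha : (u, v) ∈ T.arcs) : u ∉ L := by
  rcases Relation.ReflTransGen.cases_tail (h v) with he | ⟨w, -, hw⟩
  · exact absurd (he ▸ ha) (hT.root_not_head u)
  · rcases hw.2.2 with hw' | hw'
    · exact hT.parent_unique hw' ha ▸ hw.2.1
    · exact absurd (hT.head_mem ha) hw'

/-- Tree vertices are reached along the new tree; on an old walk, an arc into a vertex outside the
new tree is still an arc of the new `D̂`. -/
theorem expand (h : Spans D T L) (hT : T.IsOutTree D) {x : Fin n} {Y : List (Fin n)}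
    (hx : CanExpand D L T x Y) : Spans D (T.expand x Y) L := by
  have hT' := hx.isOutTree hT
  have htree : ∀ v ∈ (T.expand x Y).verts,
      Relation.ReflTransGen (HatArc D (T.expand x Y) L) T.root v := fun v hv => by
    refine Relation.ReflTransGen.mono (fun a b hab => ⟨hT'.adj _ hab, ?_, Or.inl hab⟩) _ _
      (hT'.reach v hv)
    rcases mem_arcs_expand.1 hab with ⟨rfl, -⟩ | ha
    · exact hx.not_mem_left
    · exact h.tail_not_mem hT ha
  intro v
  change Relation.ReflTransGen (HatArc D (T.expand x Y) L) T.root v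
  induction h v with
  | refl => exact .refl
  | @tail b c _ hbc ih =>
    by_cases hc : c ∈ (T.expand x Y).verts
    · exact htree c hc
    · exact ih.tail ⟨hbc.1, hbc.2.1, Or.inr hc⟩

/-- If no arc of `D̂` left `x`, putting `x` into `L` would delete nothing. Hence a leaf forced in
Step 2 can really be expanded. -/
theorem exists_hatArc (h : Spans D T L) {x : Fin n} (hx : ¬ Spans D T (x :: L)) :
    ∃ v, HatArc D T L x v := by
  by_contra! hno
  refine hx fun v => Relation.ReflTransGen.mono (fun a b hab => ⟨hab.1, ?_, hab.2.2⟩) _ _ (h v)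
  rintro ha
  rcases List.mem_cons.1 ha with rfl | ha
  · exact hno b hab
  · exact hab.2.1 ha

end Spans

/-! ### Consecutive leaves below a red vertex. -/

/-- The leaves of `T` that are descendants of `z` are the consecutive entries `F` of the list
`T.leaves = pre ++ F ++ post`, and no internal vertex of `T` properly below `z` is red. -/
structure Region (T : OutTree n) (red : RedList n) (z : Fin n) (pre F post : List (Fin n)) :
    Prop where
  mem : z ∈ T.verts
  leaves_eq : T.leaves = pre ++ F ++ post
  desc_iff : ∀ v ∈ T.leaves, T.Desc z v ↔ v ∈ F
  not_red : ∀ w, T.Desc z w → w ≠ z → (∃ v, (w, v) ∈ T.arcs) → ∀ r ∈ red, r.1 ≠ w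

namespace Region

variable {D : Digraph (Fin n)} {L : List (Fin n)} {T : OutTree n} {red : RedList n} {x z : Fin n}
  {pre F post Y : List (Fin n)}

theorem of_leaf (hT : T.IsOutTree D) (red : RedList n) (h : T.leaves = pre ++ x :: post) :
    Region T red x pre [x] post := by
  have hx : x ∈ T.leaves := by simp [h]
  refine ⟨hT.leaf_mem hx, by simp [h], fun v _ => ?_, fun w hw hwx => ?_⟩
  · rw [List.mem_singleton]
    exact ⟨hT.desc_leaf hx, fun h => h ▸ .refl⟩
  · exact absurd (hT.desc_leaf hx hw) hwx

/-- Only `x` becomes internal, so it is enough that `x` is `z` itself or is not red. -/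
theorem not_red_expand (h : Region T red z pre F post) (hT : T.IsOutTree D)
    (hx : CanExpand D L T x Y) (hxr : x = z ∨ ∀ r ∈ red, r.1 ≠ x) (w : Fin n)
    (hw : (T.expand x Y).Desc z w) (hwz : w ≠ z) (ha : ∃ v, (w, v) ∈ (T.expand x Y).arcs) :
    ∀ r ∈ red, r.1 ≠ w := by
  obtain ⟨v, ha⟩ := ha
  rcases mem_arcs_expand.1 ha with ⟨rfl, -⟩ | ha
  · exact hxr.resolve_left hwz
  · refine h.not_red w ?_ hwz ⟨v, ha⟩
    rcases (hx.desc_expand hT h.mem).1 hw with ⟨-, h⟩ | ⟨hY, -⟩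
    · exact h
    · exact absurd (hT.tail_mem _ ha) (hx.not_mem_verts hT hY)

theorem desc_iff_expand (h : Region T red z pre F post) (hT : T.IsOutTree D)
    (hx : CanExpand D L T x Y) {v : Fin n} (hv : v ∈ (T.expand x Y).leaves) :
    (T.expand x Y).Desc z v ↔ (v ∈ F ∧ v ≠ x) ∨ (v ∈ Y ∧ x ∈ F) := by
  have hT' := hx.isOutTree hT
  rw [hx.desc_expand hT h.mem, h.desc_iff x hx.mem_leaves]
  refine or_congr_left (Iff.intro ?_ ?_)
  · rintro ⟨hvT, hd⟩
    have hvl : v ∈ T.leaves := (hT.mem_leaves v).2 ⟨hvT, fun a ha =>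
      ((hT'.mem_leaves v).1 hv).2 a (List.mem_append_right _ ha)⟩
    refine ⟨(h.desc_iff v hvl).1 hd, ?_⟩
    rintro rfl
    obtain ⟨y, hy⟩ := List.exists_mem_of_ne_nil _ hx.ne_nil
    exact hT'.leaf_not_tail hv (mem_arcs_expand.2 (Or.inl ⟨rfl, hy⟩))
  · rintro ⟨hvF, hvx⟩
    have hvl : v ∈ T.leaves := by rw [h.leaves_eq]; simp [hvF]
    exact ⟨hT.leaf_mem hvl, (h.desc_iff v hvl).2 hvF⟩

theorem expand_mid {F₁ F₂ : List (Fin n)} (h : Region T red z pre (F₁ ++ x :: F₂) post)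
    (hT : T.IsOutTree D) (hx : CanExpand D L T x Y) (hxr : x = z ∨ ∀ r ∈ red, r.1 ≠ x) :
    Region (T.expand x Y) red z pre (F₁ ++ Y ++ F₂) post := by
  have hl : T.leaves = (pre ++ F₁) ++ x :: (F₂ ++ post) := by simp [h.leaves_eq]
  refine ⟨mem_verts_expand.2 (Or.inr h.mem), ?_, fun v hv => ?_, h.not_red_expand hT hx hxr⟩
  · simp [leaves_expand hl hT.leaves_nodup]
  · rw [h.desc_iff_expand hT hx hv]
    have hnd := hT.leaves_nodup
    rw [hl, List.nodup_middle, List.nodup_cons] at hnd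
    have : v ∈ F₁ ++ F₂ → v ≠ x := by
      intro hvF hvx
      apply hnd.1
      rw [← hvx]
      simp only [List.mem_append] at hvF ⊢
      tauto
    simp only [List.mem_append, List.mem_cons] at this ⊢
    tauto

theorem expand_post {P₁ P₂ : List (Fin n)} (h : Region T red z pre F (P₁ ++ x :: P₂))
    (hT : T.IsOutTree D) (hx : CanExpand D L T x Y) (hxr : x = z ∨ ∀ r ∈ red, r.1 ≠ x) :
    Region (T.expand x Y) red z pre F (P₁ ++ Y ++ P₂) := by
  have hl : T.leaves = (pre ++ F ++ P₁) ++ x :: P₂ := by simp [h.leaves_eq]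
  have hnd := hT.leaves_nodup
  rw [hl, List.nodup_middle, List.nodup_cons] at hnd
  have hxF : x ∉ F := fun hF => hnd.1 (by simp [hF])
  refine ⟨mem_verts_expand.2 (Or.inr h.mem), ?_, fun v hv => ?_, h.not_red_expand hT hx hxr⟩
  · simp [leaves_expand hl hT.leaves_nodup]
  · rw [h.desc_iff_expand hT hx hv]
    constructor
    · rintro (⟨h, -⟩ | ⟨-, h⟩)
      · exact h
      · exact absurd h hxF
    · exact fun h => Or.inl ⟨h, fun e => hxF (e ▸ h)⟩

end Region

end OutTree

/-! ### Running times and results of the subroutines -/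

namespace HaltsIn

theorem of_length_le {α : Type} {p : Prog α} {l m c : ℕ} {Q : α → Prop}
    (h : HaltsIn p (l * c + 1) Q) (hl : l ≤ m) : HaltsIn p (m * c + 1) Q :=
  h.le (Nat.add_le_add_right (Nat.mul_le_mul_right _ hl) _)

end HaltsIn

section Algorithm

open OutTree

variable {n : ℕ}

theorem List.Nodup.length_le_fin {L : List (Fin n)} (h : L.Nodup) : L.length ≤ n := by
  simpa using h.length_le_card

theorem inHatP_haltsIn {D : Digraph (Fin n)} [DecidableRel D.Adj] {T : OutTree n}
    {L : List (Fin n)} (hT : T.IsOutTree D) (hL : L.Nodup) (e : Fin n × Fin n) :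
    HaltsIn (inHatP D T L e) (4 * n + 6) (· = (decide (D.Adj e.1 e.2) && (!decide (e.1 ∈ L) &&
        (decide (e ∈ T.arcs) || !decide (e.2 ∈ T.verts))))) := by
  have hA := hT.length_arcs_lt
  have hLn := hL.length_le_fin
  suffices HaltsIn (inHatP D T L e) (4 * n + 6) (fun _ => True) from
    (this.and_returns (returns_inHatP D T L e)).mono le_rfl fun b hb => hb.1
  refine HaltsIn.tick_bind (d := 4 * n + 5) ?_
  by_cases h : D.Adj e.1 e.2
  · rw [if_pos h]
    refine ((memP_haltsIn e.1 L).bind fun b _ => (memArcP_haltsIn e T.arcs).bind fun b' _ =>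
      HaltsIn.bind (c := 2 * n + 2) (Q := fun _ => True) ?_ fun _ _ =>
        HaltsIn.pure (c := 0) trivial).le (by omega)
    refine (HaltsIn.tick_bind ((mapP_haltsIn T.arcs (c := 0) (g := Prod.snd)
      fun _ _ => HaltsIn.pure rfl).bind fun H hH =>
        ((memP_haltsIn _ _).mono (d := n + 1) ?_ fun _ _ => trivial))).le (by omega)
    simp only [hH, List.length_cons, List.length_map]
    omega
  · rw [if_neg h]
    exact HaltsIn.pure trivial

theorem hatP_haltsIn {D : Digraph (Fin n)} [DecidableRel D.Adj] {T : OutTree n}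
    {L : List (Fin n)} (hT : T.IsOutTree D) (hL : L.Nodup) :
    HaltsIn (hatP D T L) ((n + 10) ^ 4) fun H =>
      H.Nodup ∧ H.length ≤ n ^ 2 ∧ ∀ u v, (u, v) ∈ H ↔ HatArc D T L u v := by
  refine (HaltsIn.tick_bind ((pairsP_haltsIn (List.finRange n)).bind
    (d := n ^ 2 * (4 * n + 7) + 1) fun P hP => ?_)).le ?_
  · have hPn : P.Nodup := by
      rw [hP]
      exact (List.nodup_finRange n).product (List.nodup_finRange n)
    have hlen : ∀ H : List (Fin n × Fin n), H.Nodup → H.length ≤ n ^ 2 := fun H hH => by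
      simpa [sq] using hH.length_le_card
    refine ((filterP_haltsIn P fun e _ => inHatP_haltsIn hT hL e).of_length_le
      (hlen P hPn)).mono le_rfl fun H hH => ?_
    have hHn : H.Nodup := hH ▸ hPn.filter _
    refine ⟨hHn, hlen H hHn, fun u v => ?_⟩
    simp [hH, hP, HatArc]
  · rw [List.length_finRange]
    ring_nf
    omega

theorem reachP_haltsIn_pow {A : List (Fin n × Fin n)} (hA : A.length ≤ n ^ 2) {N : ℕ}
    (hN : n ≤ N) (r : Fin n) :
    HaltsIn (reachP A N [r]) ((n + 10) ^ 5) fun R =>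
        R.Nodup ∧ ∀ v, v ∈ R ↔ Relation.ReflTransGen (fun a b => (a, b) ∈ A) r v := by
  refine (reachP_haltsIn A N [r] (List.nodup_singleton r) (by simp; omega)).mono ?_
    fun R hR => ⟨hR.1, by simpa using hR.2⟩
  simp only [List.length_singleton, Nat.add_sub_cancel]
  calc n * (A.length * (2 * n + 3) + 2) ≤ n * (n ^ 2 * (2 * n + 3) + 2) := by gcongr
    _ ≤ (n + 10) ^ 5 := by ring_nf; omega

theorem hasBranchingP_haltsIn {D : Digraph (Fin n)} [DecidableRel D.Adj] {T : OutTree n}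
    {L : List (Fin n)} (hT : T.IsOutTree D) (hL : L.Nodup) {N : ℕ} (hN : n ≤ N) :
    HaltsIn (hasBranchingP N D T L) ((n + 10) ^ 6) fun b => b = true ↔ Spans D T L := by
  refine (HaltsIn.tick_bind ((hatP_haltsIn hT hL).bind fun H hH =>
    (reachP_haltsIn_pow hH.2.1 hN T.root).bind (d := n * (n + 2) + 1) fun S hS =>
      HaltsIn.bind (d := 0) ((findP_haltsIn (q := fun v => v ∉ S) (c := n + 1) _
        fun v _ => ?_).of_length_le (by simp)) fun u hu => HaltsIn.pure ?_)).le ?_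
  · refine ((memP_haltsIn v S).bind (d := 0) fun b hb => HaltsIn.pure ?_).le ?_
    · simp [← hb]
    · have := hS.1.length_le_fin
      omega
  · have hHe : (fun a b => (a, b) ∈ H) = HatArc D T L := by
      funext a b
      exact propext (hH.2.2 a b)
    have hsp : Spans D T L ↔ ∀ v, v ∈ S := by
      refine forall_congr' fun v => ?_
      rw [hS.2, hHe]
    rw [hsp]
    rcases hu with ⟨rfl, hu⟩ | ⟨v, -, -, rfl, -, hv, -⟩
    · simpa using hu
    · simpa using ⟨v, hv⟩
  · ring_nf
    omega

theorem outNbrsP_haltsIn_nodup {H : List (Fin n × Fin n)} (hH : H.Nodup) (hn : H.length ≤ n ^ 2)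
    (x : Fin n) :
    HaltsIn (outNbrsP x H) (n ^ 2 + 1) fun Y => Y.Nodup ∧ ∀ v, v ∈ Y ↔ (x, v) ∈ H := by
  refine (outNbrsP_haltsIn x H).mono (by omega) fun Y hY => ⟨?_, fun v => ?_⟩
  · rw [hY]
    refine List.Nodup.map_on ?_ (hH.filter _)
    rintro ⟨a, b⟩ ha ⟨c, d⟩ hc h
    simp only [List.mem_filter, decide_eq_true_eq] at ha hc h
    rw [ha.2, hc.2, h]
  · rw [hY]
    simp

theorem addOutP_haltsIn {D : Digraph (Fin n)} {T : OutTree n} (hT : T.IsOutTree D) (x : Fin n)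
    {Y : List (Fin n)} (hY : Y.Nodup) :
    HaltsIn (addOutP T x Y) ((n + 10) ^ 2) fun T' => Y ≠ [] → T' = T.expand x Y := by
  have hYn := hY.length_le_fin
  have hl := hT.length_leaves_le
  cases Y with
  | nil =>
    refine HaltsIn.le (c := 1) ?_ (Nat.pow_pos (by omega))
    exact HaltsIn.tick_bind (HaltsIn.pure fun h => absurd rfl h)
  | cons y Z =>
    refine (HaltsIn.tick_bind ((mapP_haltsIn (y :: Z) (c := 0) (g := fun v => (x, v))
      fun _ _ => HaltsIn.pure rfl).bind fun A hA => (appendP_haltsIn A T.arcs).le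
        (d := n + 1) (by rw [hA, List.length_map]; omega) |>.bind fun A' hA' =>
          (replaceP_haltsIn x (y :: Z) hT.leaves_nodup).bind (d := 0) fun F hF =>
            HaltsIn.pure fun _ => ?_)).le ?_
    · rw [hA', hA, hF]
      rfl
    · simp only [zero_add, mul_one]
      calc _ ≤ 4 * n + 10 := by omega
        _ ≤ _ := by ring_nf; omega

/-- One expansion, performed by the programs for `D̂(T, L)`, its out-neighbours, and `addOutP`. -/
theorem expand_haltsIn {β : Type} {D : Digraph (Fin n)} [DecidableRel D.Adj] {T : OutTree n}
    {L : List (Fin n)} (hT : T.IsOutTree D) (hL : L.Nodup) {x : Fin n} (hx : x ∈ T.leaves)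
    {f : List (Fin n) → OutTree n → Prog β} {d : ℕ} {R : β → Prop}
    (h₀ : (∀ v, ¬ HatArc D T L x v) → ∀ T', HaltsIn (f [] T') d R)
    (h₁ : ∀ Y, CanExpand D L T x Y → HaltsIn (f Y (T.expand x Y)) d R) :
    HaltsIn (do
      let H ← hatP D T L
      let Y ← outNbrsP x H
      let T' ← addOutP T x Y
      f Y T') (2 * (n + 10) ^ 4 + d) R := by
  refine ((hatP_haltsIn hT hL).bind fun H hH => (outNbrsP_haltsIn_nodup hH.1 hH.2.1 x).bind
    fun Y hY => (addOutP_haltsIn hT x hY.1).bind (d := d) fun T' hT' => ?_).le ?_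
  · by_cases hne : Y = []
    · subst hne
      exact h₀ (fun v hv => by simpa using (hY.2 v).2 ((hH.2.2 x v).2 hv)) T'
    · rw [hT' hne]
      exact h₁ Y ⟨hx, hne, hY.1, fun v => (hY.2 v).trans (hH.2.2 x v)⟩
  · ring_nf
    omega

theorem length_arcs_expand {T : OutTree n} {x : Fin n} {Y : List (Fin n)} (hY : Y ≠ []) :
    T.arcs.length < (T.expand x Y).arcs.length := by
  have := List.length_pos_iff.2 hY
  simp [expand]
  omega

/-- Every round adds an arc, and an out-tree has fewer than `n` arcs. The bound on `N` is about
twice what the rounds need, so that each inner reachability test still has depth at least `n`. -/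
theorem forceP_haltsIn {D : Digraph (Fin n)} [DecidableRel D.Adj] {L : List (Fin n)}
    (hL : L.Nodup) {N : ℕ} {T : OutTree n} (hT : T.IsOutTree D) (hs : Spans D T L)
    (hN : 2 * n + 1 ≤ N + T.arcs.length) :
    HaltsIn (forceP D L N T) ((n - T.arcs.length) * (n + 10) ^ 8) fun T₁ =>
      Relation.ReflTransGen (Expands D L) T T₁ ∧
        ∀ x ∈ T₁.leaves, x ∉ L → Spans D T₁ (x :: L) := by
  induction N generalizing T with
  | zero =>
    have := hT.length_arcs_lt
    omega
  | succ N ih =>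
    have hA := hT.length_arcs_lt
    obtain ⟨m, hm⟩ : ∃ m, n - T.arcs.length = m + 1 := ⟨n - T.arcs.length - 1, by omega⟩
    rw [hm]
    refine (HaltsIn.tick_bind (((findP_haltsIn (c := (n + 1) + (n + 10) ^ 6)
      (q := fun x => x ∉ L ∧ ¬ Spans D T (x :: L)) T.leaves (fun x _ => ?_)).of_length_le
        hT.length_leaves_le).bind (d := 2 * (n + 10) ^ 4 + m * (n + 10) ^ 8) fun o ho => ?_)).le ?_
    · refine ((memP_haltsIn x L).le (d := n + 1) (by have := hL.length_le_fin; omega)).bind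
        fun b hb => ?_
      cases b
      · have hxL : x ∉ L := by simpa using hb
        refine ((hasBranchingP_haltsIn hT (List.nodup_cons.2 ⟨hxL, hL⟩) (N := N) (by omega)).bind
          (d := 0) fun b' hb' => HaltsIn.pure ?_)
        simp [hxL, ← hb']
      · exact HaltsIn.pure (by simpa using fun h => absurd (hb.1 rfl) h)
    · rcases ho with ⟨rfl, ho⟩ | ⟨x, l₁, l₂, rfl, hl, hx, -⟩
      · exact HaltsIn.pure ⟨.refl, fun x hx hxL => by simpa [hxL] using ho x hx⟩
      · refine expand_haltsIn hT hL (x := x) (by simp [hl])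
          (f := fun _ T' => forceP D L N T') ?_ fun Y hY => ?_
        · intro hno
          obtain ⟨v, hv⟩ := hs.exists_hatArc hx.2
          exact absurd hv (hno v)
        · have hlt := length_arcs_expand (T := T) (x := x) hY.ne_nil
          refine (ih (hY.isOutTree hT) (hs.expand hT hY) (by omega)).mono
            (Nat.mul_le_mul_right _ (by omega)) fun T₁ h₁ => ⟨?_, h₁.2⟩
          exact h₁.1.head ⟨x, Y, hY, rfl⟩
    · have : n * (n + 1 + (n + 10) ^ 6 + 1) + 1 + (2 * (n + 10) ^ 4) + 1 ≤ (n + 10) ^ 8 := by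
        ring_nf
        omega
      rw [add_mul]
      omega

/-! ### Growing `T^root(x)` and finding the nearest red ancestor. -/

/-- Every red vertex lies in `L` or is an internal vertex of `T`. -/
def RedInactive (T : OutTree n) (L : List (Fin n)) (red : RedList n) : Prop :=
  ∀ r ∈ red, r.1 ∈ L ∨ ∃ v, (r.1, v) ∈ T.arcs

namespace RedInactive

variable {D : Digraph (Fin n)} {L : List (Fin n)} {T : OutTree n} {red : RedList n}

theorem expand (h : RedInactive T L red) (x : Fin n) (Y : List (Fin n)) :
    RedInactive (T.expand x Y) L red := fun r hr =>
  (h r hr).imp_right fun ⟨v, hv⟩ => ⟨v, mem_arcs_expand.2 (Or.inr hv)⟩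

theorem ne_of_leaf (h : RedInactive T L red) (hT : T.IsOutTree D) {x : Fin n}
    (hx : x ∈ T.leaves) (hxL : x ∉ L) : ∀ r ∈ red, r.1 ≠ x := by
  rintro r hr rfl
  rcases h r hr with h | ⟨v, hv⟩
  · exact hxL h
  · exact hT.leaf_not_tail hx hv

end RedInactive

/-- Here `z` is the start of the growth and `x` its present end, so that the induction can move
along the path. At first they coincide; after one expansion all out-neighbours of `z` in `D` lie in
the tree, and this persists. The postcondition is restricted to at least two leaves because
otherwise Step 4.4 discards the tree. -/
theorem growTreeP_haltsIn {D : Digraph (Fin n)} [DecidableRel D.Adj] {L : List (Fin n)}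
    (hL : L.Nodup) {red : RedList n} {z : Fin n} {pre post : List (Fin n)} {N : ℕ} {T : OutTree n}
    {x : Fin n} (hT : T.IsOutTree D) (hN : n ≤ N + T.arcs.length)
    (hR : Region T red z pre [x] post) (hred : RedInactive T L red)
    (hz : z = x ∨ ∀ v, D.Adj z v → v ∈ T.verts) :
    HaltsIn (growTreeP D L N T x) ((n - T.arcs.length) * (n + 10) ^ 5) fun r =>
      2 ≤ r.2.length → Relation.ReflTransGen (Expands D L) T r.1 ∧
        Region r.1 red z pre r.2 post ∧ r.2.Nodup ∧ (∀ q ∈ r.2, q ∉ T.verts) ∧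
        (∀ v, D.Adj z v → v ∈ r.1.verts) ∧ T.arcs.length < r.1.arcs.length := by
  induction N generalizing T x with
  | zero =>
    have := hT.length_arcs_lt
    omega
  | succ N ih =>
    have hA := hT.length_arcs_lt
    obtain ⟨m, hm⟩ : ∃ m, n - T.arcs.length = m + 1 := ⟨n - T.arcs.length - 1, by omega⟩
    rw [hm]
    have hx : x ∈ T.leaves := by simp [hR.leaves_eq]
    refine (HaltsIn.tick_bind (expand_haltsIn (d := m * (n + 10) ^ 5) hT hL hx
      (f := fun Y T' => match Y with
        | [] => (return (T', [x]) : Prog (OutTree n × List (Fin n)))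
        | [y] => growTreeP D L N T' y
        | y₁ :: y₂ :: Z => return (T', y₁ :: y₂ :: Z)) (fun _ T' => ?_) fun Y hY => ?_)).le ?_
    · exact HaltsIn.pure (by simp)
    · have hlt := length_arcs_expand (T := T) (x := x) hY.ne_nil
      have hT' := hY.isOutTree hT
      have hR' : Region (T.expand x Y) red z pre Y post := by
        simpa using Region.expand_mid (F₁ := []) (F₂ := []) (by simpa using hR) hT hY
          (Or.inr (hred.ne_of_leaf hT hx hY.not_mem_left))
      have hz' : ∀ v, D.Adj z v → v ∈ (T.expand x Y).verts := fun v hv => by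
        rcases hz with rfl | hz
        · exact hY.adj_mem_verts hv
        · exact mem_verts_expand.2 (Or.inr (hz v hv))
      have hstep : Expands D L T (T.expand x Y) := ⟨x, Y, hY, rfl⟩
      match Y, hY, hlt, hT', hR', hz', hstep with
      | [], hY, _, _, _, _, _ => exact absurd rfl hY.ne_nil
      | [y], hY, hlt, hT', hR', hz', hstep =>
        refine (ih hT' (by omega) hR' (hred.expand _ _) (Or.inr hz')).mono
          (Nat.mul_le_mul_right _ (by omega)) fun r hr h2 => ?_
        obtain ⟨h₁, h₂, h₃, h₄, h₅, h₆⟩ := hr h2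
        exact ⟨h₁.head hstep, h₂, h₃, fun q hq hqT => h₄ q hq (mem_verts_expand.2 (Or.inr hqT)),
          h₅, by omega⟩
      | y₁ :: y₂ :: Z, hY, hlt, hT', hR', hz', hstep =>
        exact HaltsIn.pure fun _ => ⟨.single hstep, hR', hY.nodup,
          fun q hq => hY.not_mem_verts hT hq, hz', hlt⟩
    · have : 2 * (n + 10) ^ 4 + 1 ≤ (n + 10) ^ 5 := by
        ring_nf
        omega
      rw [add_mul]
      omega

open Classical in
/-- The ancestors of `v` in `T` (including `v`). -/
noncomputable def OutTree.ancestors (T : OutTree n) (v : Fin n) : Finset (Fin n) :=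
  Finset.univ.filter fun u => T.Desc u v

theorem OutTree.IsOutTree.card_ancestors_lt {D : Digraph (Fin n)} {T : OutTree n}
    (hT : T.IsOutTree D) {u v : Fin n} (h : (u, v) ∈ T.arcs) :
    (T.ancestors u).card < (T.ancestors v).card := by
  refine Finset.card_lt_card (Finset.ssubset_iff_subset_ne.2 ⟨fun w hw => ?_, fun he => ?_⟩)
  · simp only [ancestors, Finset.mem_filter, Finset.mem_univ, true_and] at hw ⊢
    exact hw.tail h
  · have : v ∈ T.ancestors u := by
      rw [he]
      simp only [ancestors, Finset.mem_filter, Finset.mem_univ, true_and]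
      exact .refl
    simp only [ancestors, Finset.mem_filter, Finset.mem_univ, true_and] at this
    exact hT.acyclic (hT.head_mem h) (Relation.TransGen.tail' this h)

/-- Passing to the parent lowers the number of ancestors. If no internal vertex properly below `z`
is red, the climb cannot stop before `z`. -/
theorem nearestRedP_haltsIn {D : Digraph (Fin n)} {T : OutTree n} (hT : T.IsOutTree D)
    {red : RedList n} (hred : red.length ≤ 2 * n) {N : ℕ} {x : Fin n}
    (hN : (T.ancestors x).card ≤ N) :
    HaltsIn (nearestRedP T red N x) ((T.ancestors x).card * (n + 10) ^ 2) fun o =>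
      (∀ r, o = some r → r ∈ red) ∧
        ∀ z H, red.find? (fun r => decide (r.1 = z)) = some (z, H) → T.Desc z x → x ≠ z →
          (∀ w, T.Desc z w → w ≠ z → (∃ v, (w, v) ∈ T.arcs) → ∀ r ∈ red, r.1 ≠ w) →
            o = some (z, H) := by
  have hpos : ∀ x, 0 < (T.ancestors x).card := fun x => Finset.card_pos.2 ⟨x, by
    simp only [ancestors, Finset.mem_filter, Finset.mem_univ, true_and]
    exact .refl⟩
  induction N generalizing x with
  | zero =>
    have := hpos x
    omega
  | succ N ih =>
    obtain ⟨m, hm⟩ : ∃ m, (T.ancestors x).card = m + 1 :=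
      ⟨(T.ancestors x).card - 1, by have := hpos x; omega⟩
    rw [hm]
    have hA := hT.length_arcs_lt
    refine (HaltsIn.tick_bind (((findP_haltsIn (c := 1) (q := fun a => a.2 = x) T.arcs fun a _ =>
      HaltsIn.tick_bind (d := 0) (HaltsIn.pure (by simp))).of_length_le hA.le).bind
        (d := 2 * n * 2 + 1 + m * (n + 10) ^ 2) fun e he => ?_)).le ?_
    · rcases he with ⟨rfl, he⟩ | ⟨⟨p, x'⟩, l₁, l₂, rfl, hl, hpx, -⟩
      · refine HaltsIn.pure ⟨by simp, fun z H _ hzx hxz _ => ?_⟩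
        rcases Relation.ReflTransGen.cases_tail hzx with h | ⟨w, -, hw⟩
        · exact absurd h hxz
        · exact absurd rfl (he _ hw)
      · obtain rfl : x' = x := hpx
        have hpx : (p, x') ∈ T.arcs := by simp [hl]
        have hdesc : ∀ z, T.Desc z x' → x' ≠ z → T.Desc z p := fun z hzx hxz => by
          rcases Relation.ReflTransGen.cases_tail hzx with h | ⟨w, hzw, hw⟩
          · exact absurd h hxz
          · exact hT.parent_unique hw hpx ▸ hzw
        refine ((findP_haltsIn (c := 1) (q := fun z => z.1 = p) red fun a _ =>
          HaltsIn.tick_bind (d := 0) (HaltsIn.pure (by simp))).of_length_le hred).bind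
            (d := m * (n + 10) ^ 2) fun r hr => ?_
        rcases hr with ⟨rfl, hr⟩ | ⟨r, r₁, r₂, rfl, hrl, hrp, hr₁⟩
        · have hlt := hT.card_ancestors_lt hpx
          refine (ih (x := p) (by omega)).mono (Nat.mul_le_mul_right _ (by omega)) fun o ho =>
            ⟨ho.1, fun z H hzH hzx hxz hnr => ho.2 z H hzH (hdesc z hzx hxz) ?_ hnr⟩
          rintro rfl
          exact hr _ (List.mem_of_find?_eq_some hzH) rfl
        · have hrm : r ∈ red := by simp [hrl]
          refine HaltsIn.pure ⟨fun r' hr' => by simpa [← Option.some.inj hr'] using hrm,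
            fun z H hzH hzx hxz hnr => ?_⟩
          by_cases hpz : p = z
          · subst hpz
            -- Both searches return the first entry of `red` for `z`, so they agree on `H_z` as
            -- well.
            rw [← hzH, eq_comm, List.find?_eq_some_iff_append]
            exact ⟨by simpa using hrp, r₁, r₂, hrl, fun a ha => by simpa using hr₁ a ha⟩
          · exact absurd hrp (hnr p (hdesc z hzx hxz) hpz ⟨_, hpx⟩ r hrm)
    · have : n * (1 + 1) + 1 + (2 * n * 2 + 1) + 1 ≤ (n + 10) ^ 2 := by
        ring_nf
        omega
      rw [add_mul]
      omega

/-- Only the heads of arcs are required to lie in `S`, so a walk from `p ∉ S` has no vertex other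
than its start outside `T_z`. -/
theorem pathStartP_haltsIn {N : ℕ} (hN : n ≤ N) {H : List (Fin n × Fin n)}
    (hH : H.length ≤ n ^ 2) (z : Fin n) {Z S : List (Fin n)} (hZ : Z.Nodup) (hS : S.Nodup) :
    HaltsIn (pathStartP N H z Z S) ((n + 10) ^ 7) fun o =>
      (o = none ∧ ∀ p ∉ S, ¬ ∃ v ∈ Z, Relation.ReflTransGen
        (fun a b => (a, b) ∈ H ∧ b ∈ S ∧ ¬ (a = z ∧ b ∈ Z)) p v) ∨
      ∃ p, o = some p ∧ p ∉ S ∧ ∃ v ∈ Z, Relation.ReflTransGen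
        (fun a b => (a, b) ∈ H ∧ b ∈ S ∧ ¬ (a = z ∧ b ∈ Z)) p v := by
  have hZn := hZ.length_le_fin
  have hSn := hS.length_le_fin
  refine (HaltsIn.tick_bind (((filterP_haltsIn (c := 2 * n + 2)
    (q := fun a => decide (a.2 ∈ S ∧ ¬ (a.1 = z ∧ a.2 ∈ Z))) H (fun a _ => ?_)).of_length_le
      hH).bind (d := n * (n + 1 + ((n + 10) ^ 5 + (n * (n + 2) + 1)) + 1) + 1)
        fun A hA => ?_)).le ?_
  · refine ((memP_haltsIn a.2 S).bind fun b₁ h₁ => (memP_haltsIn a.2 Z).bind (d := 0)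
      fun b₂ h₂ => HaltsIn.pure ?_).le (by omega)
    simp only [← h₁, ← h₂]
    cases b₁ <;> cases b₂ <;> simp
  · have hAe : (fun a b => (a, b) ∈ A) =
        fun a b => (a, b) ∈ H ∧ b ∈ S ∧ ¬ (a = z ∧ b ∈ Z) := by
      funext a b
      simp only [hA, List.mem_filter, decide_eq_true_eq]
    have hAn : A.length ≤ n ^ 2 := hA ▸ (List.length_filter_le _ _).trans hH
    refine ((findP_haltsIn (c := n + 1 + ((n + 10) ^ 5 + (n * (n + 2) + 1)))
      (q := fun p => p ∉ S ∧ ∃ v ∈ Z, Relation.ReflTransGen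
        (fun a b => (a, b) ∈ H ∧ b ∈ S ∧ ¬ (a = z ∧ b ∈ Z)) p v)
      (List.finRange n) (fun p _ => ?_)).of_length_le (by simp)).mono le_rfl fun o ho => ?_
    · refine ((memP_haltsIn p S).le (d := n + 1) (by omega)).bind fun b hb => ?_
      cases b
      · have hpS : p ∉ S := by simpa using hb
        refine (reachP_haltsIn_pow hAn hN p).bind fun R hR =>
          ((findP_haltsIn (c := n + 1) (q := fun v => v ∈ R) Z fun v _ =>
            (memP_haltsIn v R).le (by have := hR.1.length_le_fin; omega)).of_length_le
              hZn).bind (d := 0) fun q hq => HaltsIn.pure ?_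
        rw [hAe] at hR
        simp only [hpS, not_false_eq_true, true_and]
        simp only [← hR.2]
        rcases hq with ⟨rfl, hq⟩ | ⟨v, l₁, l₂, rfl, hl, hv, -⟩
        · simpa using hq
        · exact iff_of_true rfl ⟨v, by simp [hl], hv⟩
      · exact HaltsIn.pure (by simpa using fun h => absurd (hb.1 rfl) h)
    · rcases ho with ⟨rfl, ho⟩ | ⟨p, -, -, rfl, -, hp, -⟩
      · exact Or.inl ⟨rfl, fun p hp hv => ho p (List.mem_finRange p) ⟨hp, hv⟩⟩
      · exact Or.inr ⟨p, rfl, hp⟩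
  · ring_nf
    omega

/-! ### The extra vertex of Step 4.2. -/

/-- A red vertex `z` such that `T_z` has exactly two leaves `a` and `b`, which come next in
depth-first order, together with what is known about the arc list `H` of `H_z`: all vertices can
be reached in `H_z - A⁺(z)` from the root, and a vertex of `L` with an out-neighbour in `H_z`
belongs to `T_z`. -/
structure FocusAt (D : Digraph (Fin n)) (T : OutTree n) (L : List (Fin n)) (red : RedList n)
    (z : Fin n) (H : List (Fin n × Fin n)) (pre F post : List (Fin n)) : Prop where
  region : Region T red z pre F post
  pre_subset : pre ⊆ L
  find_red : red.find? (fun r => decide (r.1 = z)) = some (z, H)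
  adj_mem : ∀ v, D.Adj z v → v ∈ T.verts
  tail : ∀ u v, (u, v) ∈ H → u ∈ L → T.Desc z u
  reach : ∀ v, Relation.ReflTransGen (fun u w => (u, w) ∈ H ∧ u ≠ z) T.root v

namespace FocusAt

variable {D : Digraph (Fin n)} {T : OutTree n} {L : List (Fin n)} {red : RedList n} {z : Fin n}
  {H : List (Fin n × Fin n)} {pre post : List (Fin n)} {a b : Fin n}

/-- A leaf has no descendant but itself, while `z` has the two distinct leaves `a` and `b` below it.
-/
theorem ne_of_mem (h : FocusAt D T L red z H pre [a, b] post) (hT : T.IsOutTree D) {x : Fin n}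
    (hx : x ∈ T.leaves) : x ≠ z := by
  rintro rfl
  have hl := h.region.leaves_eq
  have hab : a ≠ b := by
    have := hT.leaves_nodup
    rw [hl, List.nodup_append', List.nodup_append'] at this
    simpa using this.1.2.1
  have ha := hT.desc_leaf hx ((h.region.desc_iff a (by simp [hl])).2 (by simp))
  have hb := hT.desc_leaf hx ((h.region.desc_iff b (by simp [hl])).2 (by simp))
  exact hab (ha.trans hb.symm)

/-- The path of Step (4.2) exists. -/
theorem exists_path (h : FocusAt D T L red z H pre [a, b] post) (hT : T.IsOutTree D)
    (hs : Spans D T L) {Z S : List (Fin n)} (hZ : ∀ v, v ∈ Z ↔ HatArc D T L z v)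
    (hS : ∀ v, v ∈ S ↔ T.Desc z v) :
    ∃ p ∉ S, ∃ v ∈ Z, Relation.ReflTransGen
      (fun a b => (a, b) ∈ H ∧ b ∈ S ∧ ¬ (a = z ∧ b ∈ Z)) p v := by
  have ha : a ∈ T.leaves := by simp [h.region.leaves_eq]
  have hza : T.Desc z a := (h.region.desc_iff a ha).2 (by simp)
  obtain ⟨y, hzy⟩ : ∃ y, (z, y) ∈ T.arcs := by
    rcases Relation.ReflTransGen.cases_head hza with he | ⟨y, hy, -⟩
    · exact absurd he.symm (h.ne_of_mem hT ha)
    · exact ⟨y, hy⟩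
  -- If the root were in `T_z` it would be `z`, and then its child `y` could not be reached without
  -- an arc out of `z`.
  have hroot : T.root ∉ S := by
    rw [hS]
    intro hd
    rcases Relation.ReflTransGen.cases_tail hd with he | ⟨w, -, hw⟩
    · rcases Relation.ReflTransGen.cases_head (h.reach y) with he' | ⟨w, hw, -⟩
      · exact hT.root_not_head z (he' ▸ hzy)
      · exact hw.2 he
    · exact hT.root_not_head w hw
  -- On a walk from the root that avoids the arcs out of `z`, the last vertex outside `S` is the
  -- required `p`.
  have key : ∀ v, v ∈ S → ∃ p ∉ S, Relation.ReflTransGen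
      (fun a b => (a, b) ∈ H ∧ b ∈ S ∧ ¬ (a = z ∧ b ∈ Z)) p v := by
    intro v
    induction h.reach v with
    | refl => exact fun hv => absurd hv hroot
    | @tail u w _ huw ih =>
      intro hw
      have hstep : (u, w) ∈ H ∧ w ∈ S ∧ ¬ (u = z ∧ w ∈ Z) := ⟨huw.1, hw, fun e => huw.2 e.1⟩
      by_cases hu : u ∈ S
      · obtain ⟨p, hp, hpu⟩ := ih hu
        exact ⟨p, hp, hpu.tail hstep⟩
      · exact ⟨u, hu, .single hstep⟩
  obtain ⟨p, hp, hpy⟩ := key y ((hS y).2 (.single hzy))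
  exact ⟨p, hp, y, (hZ y).2 ⟨hT.adj _ hzy, hs.tail_not_mem hT hzy, Or.inl hzy⟩, hpy⟩

/-- The first vertex of the path of Step (4.2) is a new element of `L`. -/
theorem not_mem_of_path (h : FocusAt D T L red z H pre [a, b] post) {Z S : List (Fin n)}
    (hZ : ∀ v, v ∈ Z ↔ HatArc D T L z v) (hS : ∀ v, v ∈ S ↔ T.Desc z v) {p v : Fin n}
    (hp : p ∉ S) (hv : v ∈ Z) (hpv : Relation.ReflTransGen
      (fun a b => (a, b) ∈ H ∧ b ∈ S ∧ ¬ (a = z ∧ b ∈ Z)) p v) : p ∉ L := by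
  intro hpL
  -- A path of length zero would make `p` an out-neighbour of `z` outside `T_z`, but all
  -- out-neighbours of `z` are already in `T`. Otherwise `p` has an out-arc in `H_z`, and if it were
  -- in `L` it would lie in `T_z`.
  rcases Relation.ReflTransGen.cases_head hpv with rfl | ⟨w, hw, -⟩
  · obtain ⟨hadj, -, hv⟩ := (hZ p).1 hv
    rcases hv with hv | hv
    · exact hp ((hS p).2 (.single hv))
    · exact hv (h.adj_mem p hadj)
  · exact hp ((hS p).2 (h.tail p w hw.1 hpL))

end FocusAt

/-- In general one or two vertices are added. The second clause guarantees two exactly when the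
credit for a pair with one active leaf falls due. -/
theorem newLeavesP_haltsIn {D : Digraph (Fin n)} {T : OutTree n} {L : List (Fin n)}
    {red : RedList n} {Hat : List (Fin n × Fin n)} {x : Fin n} {N : ℕ} (hT : T.IsOutTree D)
    (hs : Spans D T L) (hL : L.Nodup) (hN : n ≤ N) (hred : red.length ≤ 2 * n)
    (hredH : ∀ r ∈ red, r.2.length ≤ n ^ 2) (hHat : Hat.Nodup) (hHat₂ : Hat.length ≤ n ^ 2)
    (hHat₃ : ∀ u v, (u, v) ∈ Hat ↔ HatArc D T L u v) (hx : x ∈ T.leaves) (hxL : x ∉ L) :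
    HaltsIn (newLeavesP N T L red Hat x) ((n + 10) ^ 8) fun L' =>
      (L' = x :: L ∨ ∃ p, p ∉ x :: L ∧ L' = p :: x :: L) ∧
      ∀ a b z H pre post, FocusAt D T L red z H pre [a, b] post →
        (x = a ∧ b ∈ L ∨ x = b ∧ a ∈ L) → ∃ p, p ∉ x :: L ∧ L' = p :: x :: L := by
  have hLn := hL.length_le_fin
  have hA := hT.length_arcs_lt
  have hln := hT.length_leaves_le
  have hanc : (T.ancestors x).card ≤ n := by simpa using Finset.card_le_univ (T.ancestors x)
  refine (HaltsIn.tick_bind (((insertP_haltsIn x L).le (d := n + 2) (by omega)).bind fun L₁ hL₁ =>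
    ((nearestRedP_haltsIn hT hred (hanc.trans hN)).le (d := n * (n + 10) ^ 2)
      (Nat.mul_le_mul_right _ hanc)).bind (d := (n + 10) ^ 5 + ((n * (n + 2) + 1) +
        ((n * 2 + 1) + ((n + 1) + ((n ^ 2 + 1) + ((n + 10) ^ 7 + (n + 3)))))))
          fun r hr => ?_)).le ?_
  swap
  · ring_nf
    omega
  rw [if_neg hxL] at hL₁
  subst hL₁
  have hnear : ∀ a b z H pre post, FocusAt D T L red z H pre [a, b] post →
      (x = a ∧ b ∈ L ∨ x = b ∧ a ∈ L) → r = some (z, H) := by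
    intro a b z H pre post h hab
    refine hr.2 z H h.find_red ((h.region.desc_iff x hx).2 ?_) (h.ne_of_mem hT hx)
      h.region.not_red
    rcases hab with ⟨rfl, -⟩ | ⟨rfl, -⟩ <;> simp
  match r, hr, hnear with
  | none, hr, hnear =>
    exact HaltsIn.pure ⟨Or.inl rfl, fun a b z H pre post h hab => by
      simpa using hnear a b z H pre post h hab⟩
  | some (z, H), hr, hnear =>
    have hH : H.length ≤ n ^ 2 := hredH _ (hr.1 _ rfl)
    refine (reachP_haltsIn_pow (by nlinarith) hN z).bind fun S hS => ?_
    have hSn := hS.1.length_le_fin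
    refine ((filterP_haltsIn (q := fun v => decide (v ∈ S)) (c := n + 1) T.leaves fun v _ =>
      (memP_haltsIn v S).mono (by omega) fun b hb => by simp [← hb]).of_length_le hln).bind
        fun F hF => ?_
    have hFn : F.length ≤ n := by
      rw [hF]
      exact (List.length_filter_le _ _).trans hln
    refine ((filterP_haltsIn (q := fun v => decide (v ≠ x)) (c := 1) F fun v _ =>
      HaltsIn.tick_bind (d := 0) (HaltsIn.pure (by simp))).of_length_le hFn).bind fun F' hF' => ?_
    -- In a focused state the search meets precisely the `z` and `H_z` of the focus, and removing
    -- `x` from the leaves below `z` leaves exactly the other one.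
    have hfocus : ∀ a b z' H' pre post, FocusAt D T L red z' H' pre [a, b] post →
        (x = a ∧ b ∈ L ∨ x = b ∧ a ∈ L) → z' = z ∧ H' = H ∧ ∃ x' ∈ L, F' = [x'] := by
      intro a b z' H' pre post h hab
      have := hnear a b z' H' pre post h hab
      simp only [Option.some.injEq, Prod.mk.injEq] at this
      obtain ⟨rfl, rfl⟩ := this
      refine ⟨rfl, rfl, ?_⟩
      have hl := h.region.leaves_eq
      have hnd := hT.leaves_nodup
      have hF₂ : F = T.leaves.filter fun v => decide (v ∈ [a, b]) := by
        rw [hF]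
        refine List.filter_congr fun v hv => ?_
        rw [decide_eq_decide, hS.2 v]
        exact h.region.desc_iff v hv
      rw [hl, List.nodup_append', List.nodup_append'] at hnd
      obtain ⟨⟨-, hab', hd₁⟩, -, hd₂⟩ := hnd
      have e₁ : pre.filter (fun v => decide (v ∈ [a, b])) = [] :=
        List.filter_eq_nil_iff.2 fun v hv => by simpa using hd₁ hv
      have e₂ : post.filter (fun v => decide (v ∈ [a, b])) = [] :=
        List.filter_eq_nil_iff.2 fun v hv hv' =>
          hd₂ (List.mem_append_right _ (by simpa using hv')) hv
      have e₃ : [a, b].filter (fun v => decide (v ∈ [a, b])) = [a, b] :=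
        List.filter_eq_self.2 fun v hv => by simpa using hv
      rw [hl, List.filter_append, List.filter_append, e₁, e₂, e₃, List.nil_append,
        List.append_nil] at hF₂
      have hne : a ≠ b := by simpa using hab'
      rcases hab with ⟨rfl, hb⟩ | ⟨rfl, ha⟩
      · exact ⟨b, hb, by simp [hF', hF₂, hne.symm]⟩
      · exact ⟨a, ha, by simp [hF', hF₂, hne]⟩
    match F', hfocus with
    | [], hfocus =>
      exact HaltsIn.pure ⟨Or.inl rfl, fun a b z' H' pre post h hab => by
        obtain ⟨-, -, x', -, h'⟩ := hfocus a b z' H' pre post h hab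
        simp at h'⟩
    | _ :: _ :: _, hfocus =>
      exact HaltsIn.pure ⟨Or.inl rfl, fun a b z' H' pre post h hab => by
        obtain ⟨-, -, x', -, h'⟩ := hfocus a b z' H' pre post h hab
        simp at h'⟩
    | [y], hfocus =>
      refine ((memP_haltsIn y L).le (d := n + 1) (by omega)).bind fun c hc => ?_
      cases c
      · refine HaltsIn.pure ⟨Or.inl rfl, fun a b z' H' pre post h hab => ?_⟩
        obtain ⟨-, -, x', hx', h'⟩ := hfocus a b z' H' pre post h hab
        simp only [List.cons.injEq, and_true] at h'
        exact absurd (hc.2 (h' ▸ hx')) (by simp)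
      · refine (outNbrsP_haltsIn_nodup hHat hHat₂ z).bind fun Z hZ => ?_
        refine (pathStartP_haltsIn hN hH z hZ.1 hS.1).bind fun o ho => ?_
        have hZ' : ∀ v, v ∈ Z ↔ HatArc D T L z v := fun v => (hZ.2 v).trans (hHat₃ z v)
        have hS' : ∀ v, v ∈ S ↔ T.Desc z v := hS.2
        rcases ho with ⟨rfl, ho⟩ | ⟨p, rfl, hpS, v, hv, hpv⟩
        · refine HaltsIn.pure ⟨Or.inl rfl, fun a b z' H' pre post h hab => ?_⟩
          obtain ⟨rfl, rfl, -⟩ := hfocus a b z' H' pre post h hab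
          obtain ⟨p, hp, hpv⟩ := h.exists_path hT hs hZ' hS'
          exact absurd hpv (ho p hp)
        · refine (insertP_haltsIn p (x :: L)).mono (by simp only [List.length_cons]; omega)
            fun L' hL' => ⟨?_, fun a b z' H' pre post h hab => ?_⟩
          · rw [hL']
            split_ifs with hp
            · exact Or.inl rfl
            · exact Or.inr ⟨p, hp, rfl⟩
          · obtain ⟨rfl, rfl, -⟩ := hfocus a b z' H' pre post h hab
            -- The vertex `x` lies in `T_z` and `p` does not, so they differ; hence both are
            -- counted.
            have hp : p ∉ x :: L := by
              rw [List.mem_cons, not_or]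
              refine ⟨?_, h.not_mem_of_path hZ' hS' hpS hv hpv⟩
              rintro rfl
              refine hpS ((hS' p).2 ((h.region.desc_iff p hx).2 ?_))
              rcases hab with ⟨rfl, -⟩ | ⟨rfl, -⟩ <;> simp
            exact ⟨p, hp, by rw [hL', if_neg hp]⟩

/-! ### The measure -/

/-- The number of vertices of `L` outside `T`. -/
def outside (T : OutTree n) (L : List (Fin n)) : ℕ :=
  (L.filter fun v => decide (v ∉ T.verts)).length

/-- The number of entries of `F` outside `L`. -/
def active (L F : List (Fin n)) : ℕ := (F.filter fun v => decide (v ∉ L)).length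

/-- The weight of `(T, L)`: every element of `L` and every leaf of `T` contributes the factor
`125 / 241`, every vertex of `L` outside `T` the factor `6 / 5`. -/
noncomputable def weight (k : ℕ) (T : OutTree n) (L : List (Fin n)) : ℝ :=
  (241 / 125) ^ (2 * k) * (125 / 241) ^ (L.length + T.leaves.length) * (6 / 5) ^ outside T L

/-- The factor gained when the next two leaves are the only leaves below the last red vertex, and
the given number of them can still be branched on. -/
noncomputable def rate : ℕ → ℝ
  | 0 => 1
  | 1 => 17 / 20
  | _ + 2 => 23 / 25

/-- `r` is an admissible factor for the state `(T, L)` with the given red vertices. -/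
inductive HasRate (D : Digraph (Fin n)) (T : OutTree n) (L : List (Fin n)) (red : RedList n) :
    ℝ → Prop
  | one : HasRate D T L red 1
  | focus {z : Fin n} {H : List (Fin n × Fin n)} {pre post : List (Fin n)} {a b : Fin n} :
      FocusAt D T L red z H pre [a, b] post → HasRate D T L red (rate (active L [a, b]))

/-- Applied whenever a focus is given up: the factor then returns to 1, and the step that causes
this must save at least `3 / 20`. -/
theorem rate_ge (c : ℕ) : 17 / 20 ≤ rate c := by
  match c with
  | 0 => norm_num [rate]
  | 1 => norm_num [rate]
  | c + 2 => norm_num [rate]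

/-- The factor `5 / 6` comes from a vertex of `L` that enters the tree and replaces an active leaf.
The decisive case is `c = 0`, where the credit `17 / 20` is lost. -/
theorem rate_mul_le (c : ℕ) : rate c * (5 / 6) ≤ rate (c + 1) := by
  match c with
  | 0 => norm_num [rate]
  | 1 => norm_num [rate]
  | c + 2 => norm_num [rate]

theorem weight_pos (k : ℕ) (T : OutTree n) (L : List (Fin n)) : 0 < weight k T L := by
  unfold weight
  positivity

/-- The hypothesis holds past Step 3, where `L` and the set of leaves each have fewer than `k`
elements. A margin proportional to the weight is then at least a constant, which pays for the local
work. -/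
theorem one_le_weight {k : ℕ} {T : OutTree n} {L : List (Fin n)}
    (h : L.length + T.leaves.length ≤ 2 * k) : 1 ≤ weight k T L := by
  have h₁ : (1 : ℝ) ≤ (241 / 125) ^ (2 * k) * (125 / 241) ^ (L.length + T.leaves.length) := by
    calc (1 : ℝ) = (241 / 125) ^ (2 * k) * (125 / 241) ^ (2 * k) := by
          rw [← mul_pow]
          norm_num
      _ ≤ _ := by
          gcongr _ * ?_
          exact pow_le_pow_of_le_one (by norm_num) (by norm_num) h
  exact one_le_mul_of_one_le_of_one_le h₁ (one_le_pow₀ (by norm_num))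

/-- Numerically `(241 / 125) ^ 2 < 3.72`, and `125 / 241 * (6 / 5) < 1`, so an initial set `L`
outside `T` does not raise the bound. -/
theorem weight_le (k : ℕ) (T : OutTree n) (L : List (Fin n)) : weight k T L ≤ 3.72 ^ k := by
  have ho : outside T L ≤ L.length := List.length_filter_le _ _
  calc weight k T L
      = (241 / 125) ^ (2 * k) * ((125 / 241) ^ T.leaves.length *
          ((125 / 241) ^ L.length * (6 / 5) ^ outside T L)) := by
        unfold weight
        ring
    _ ≤ (241 / 125) ^ (2 * k) * (1 * ((125 / 241) ^ L.length * (6 / 5) ^ L.length)) := by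
        gcongr
        · exact pow_le_one₀ (by norm_num) (by norm_num)
        · norm_num
    _ = ((241 / 125) ^ 2) ^ k * (125 / 241 * (6 / 5)) ^ L.length := by
        rw [mul_pow, pow_mul, one_mul]
    _ ≤ 3.72 ^ k * 1 := by
        gcongr
        · norm_num
        · exact pow_le_one₀ (by norm_num) (by norm_num)
    _ = _ := mul_one _

/-- The vertices of `L` still outside `T'` and those among `Q` are disjoint sets of vertices of `L`
outside `T`. -/
theorem outside_add_le {T T' : OutTree n} {L Q : List (Fin n)} (hL : L.Nodup) (hQ : Q.Nodup)
    (hTT : T.verts ⊆ T'.verts) (hQT : ∀ q ∈ Q, q ∉ T.verts) (hQT' : Q ⊆ T'.verts) :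
    outside T' L + (Q.filter fun v => decide (v ∈ L)).length ≤ outside T L := by
  rw [outside, outside, ← List.length_append]
  refine (List.Nodup.subperm (List.nodup_append'.2 ⟨hL.filter _, hQ.filter _, ?_⟩) ?_).length_le
  · intro v hv hv'
    simp only [List.mem_filter, decide_eq_true_eq] at hv hv'
    exact hv.2 (hQT' hv'.1)
  · intro v hv
    simp only [List.mem_append, List.mem_filter, decide_eq_true_eq] at hv ⊢
    rcases hv with ⟨hv, hv'⟩ | ⟨hv, hv'⟩
    · exact ⟨hv, fun h => hv' (hTT h)⟩
    · exact ⟨hv', hQT v hv⟩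

theorem weight_le_of_leaves (k : ℕ) {T T' : OutTree n} {L : List (Fin n)} {i j : ℕ}
    (hj : T'.leaves.length = T.leaves.length + j) (hi : outside T' L + i ≤ outside T L) :
    weight k T' L ≤ (125 / 241) ^ j * (5 / 6) ^ i * weight k T L := by
  unfold weight
  rw [hj]
  calc (241 / 125 : ℝ) ^ (2 * k) * (125 / 241) ^ (L.length + (T.leaves.length + j)) *
        (6 / 5) ^ outside T' L
      = (125 / 241) ^ j * (5 / 6) ^ i * ((241 / 125) ^ (2 * k) *
          (125 / 241) ^ (L.length + T.leaves.length) * (6 / 5) ^ (outside T' L + i)) := by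
        have : (5 / 6 : ℝ) ^ i * (6 / 5) ^ i = 1 := by
          rw [← mul_pow]
          norm_num
        linear_combination (-(241 / 125 : ℝ) ^ (2 * k) * (125 / 241) ^ (L.length +
          (T.leaves.length + j)) * (6 / 5) ^ outside T' L) * this
    _ ≤ _ := by
        gcongr
        norm_num

/-- Needed for `p₀`, which may lie outside `T`; a vertex of `T` comes without the factor `6 / 5`. -/
theorem weight_cons_le (k : ℕ) (T : OutTree n) (x : Fin n) (L : List (Fin n)) :
    weight k T (x :: L) ≤ 125 / 241 * (6 / 5) * weight k T L := by
  have h : outside T (x :: L) ≤ outside T L + 1 := by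
    unfold outside
    rw [List.filter_cons]
    split_ifs <;> simp
  unfold weight
  calc _ ≤ (241 / 125 : ℝ) ^ (2 * k) * (125 / 241) ^ ((x :: L).length + T.leaves.length) *
        (6 / 5) ^ (outside T L + 1) := by
        gcongr
        norm_num
    _ = _ := by
        rw [List.length_cons]
        ring

theorem weight_cons_eq (k : ℕ) {T : OutTree n} {x : Fin n} (L : List (Fin n))
    (hx : x ∈ T.verts) : weight k T (x :: L) = 125 / 241 * weight k T L := by
  have h : outside T (x :: L) = outside T L := by
    unfold outside
    rw [List.filter_cons, if_neg (by simpa using hx)]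
  unfold weight
  rw [h, List.length_cons]
  ring

namespace OutTree.CanExpand

variable {D : Digraph (Fin n)} {L : List (Fin n)} {T : OutTree n} {x : Fin n} {Y : List (Fin n)}

theorem weight_expand_le (k : ℕ) (hx : CanExpand D L T x Y) (hT : T.IsOutTree D)
    (hL : L.Nodup) : weight k (T.expand x Y) L ≤ (125 / 241) ^ (Y.length - 1) *
      (5 / 6) ^ (Y.filter fun v => decide (v ∈ L)).length * weight k T L := by
  obtain ⟨pre, post, hl⟩ := hx.exists_leaves_eq
  have hY := List.length_pos_iff.2 hx.ne_nil
  refine weight_le_of_leaves k ?_ (outside_add_le hL hx.nodup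
    (fun v hv => mem_verts_expand.2 (Or.inr hv)) (fun q hq => hx.not_mem_verts hT hq)
    (fun v hv => mem_verts_expand.2 (Or.inl hv)))
  rw [leaves_expand hl hT.leaves_nodup, hl]
  simp only [List.length_append, List.length_cons]
  omega

end OutTree.CanExpand

/-! ### The measure under expansions. -/

/-- `H_z` is frozen when `z` is coloured, so only the clauses about `T` change, and apart from the
region they are monotone. -/
theorem FocusAt.expand {D : Digraph (Fin n)} {T : OutTree n} {L : List (Fin n)} {red : RedList n}
    {z : Fin n} {H : List (Fin n × Fin n)} {pre F F' post post' : List (Fin n)}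
    (h : FocusAt D T L red z H pre F post) {x : Fin n} {Y : List (Fin n)}
    (hR : Region (T.expand x Y) red z pre F' post') :
    FocusAt D (T.expand x Y) L red z H pre F' post' where
  region := hR
  pre_subset := h.pre_subset
  find_red := h.find_red
  adj_mem v hv := mem_verts_expand.2 (Or.inr (h.adj_mem v hv))
  tail u v huv hu := Relation.ReflTransGen.mono
    (fun _ _ h => mem_arcs_expand.2 (Or.inr h)) _ _ (h.tail u v huv hu)
  reach := h.reach

/-- This makes Step 2 free. The leaf `x` is not before the focused pair, as those leaves lie in `L`;
after the pair it is harmless. In the pair, a single new leaf takes over its place, and any loss of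
activity is paid by `5 / 6`. Two or more new leaves end the focus, and the extra leaf pays since
`125 / 241 ≤ 17 / 20`. -/
theorem HasRate.expand (k : ℕ) {D : Digraph (Fin n)} {T : OutTree n} {L : List (Fin n)}
    {red : RedList n} {r : ℝ} (h : HasRate D T L red r) (hT : T.IsOutTree D) (hL : L.Nodup)
    (hred : RedInactive T L red) {x : Fin n} {Y : List (Fin n)} (hx : CanExpand D L T x Y) :
    ∃ r', HasRate D (T.expand x Y) L red r' ∧
      r' * weight k (T.expand x Y) L ≤ r * weight k T L := by
  have hw := hx.weight_expand_le k hT hL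
  have hpos := weight_pos k T L
  have hle : weight k (T.expand x Y) L ≤ weight k T L := by
    refine hw.trans (mul_le_of_le_one_left hpos.le ?_)
    exact mul_le_one₀ (pow_le_one₀ (by norm_num) (by norm_num)) (by positivity)
      (pow_le_one₀ (by norm_num) (by norm_num))
  have hxr : ∀ z, x = z ∨ ∀ r ∈ red, r.1 ≠ x := fun z =>
    Or.inr (hred.ne_of_leaf hT hx.mem_leaves hx.not_mem_left)
  cases h with
  | one => exact ⟨1, .one, by simpa using hle⟩
  | @focus z H pre post a b h =>
    have hr : (0 : ℝ) ≤ rate (active L [a, b]) := le_trans (by norm_num) (rate_ge _)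
    have hnil : x ∉ pre := fun hp => hx.not_mem_left (h.pre_subset hp)
    have hxl := hx.mem_leaves
    rw [h.region.leaves_eq] at hxl
    -- the case of two or more new leaves in the place of `x`
    have hbig : 2 ≤ Y.length → ∃ r', HasRate D (T.expand x Y) L red r' ∧
        r' * weight k (T.expand x Y) L ≤ rate (active L [a, b]) * weight k T L := by
      intro hY
      refine ⟨1, .one, ?_⟩
      rw [one_mul]
      refine hw.trans (mul_le_mul_of_nonneg_right ?_ hpos.le)
      calc (125 / 241 : ℝ) ^ (Y.length - 1) * (5 / 6) ^ _ ≤ (125 / 241) ^ 1 * 1 := by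
            refine mul_le_mul ?_ (pow_le_one₀ (by norm_num) (by norm_num)) (by positivity)
              (by positivity)
            exact pow_le_pow_of_le_one (by norm_num) (by norm_num) (by omega)
        _ ≤ 17 / 20 := by norm_num
        _ ≤ _ := rate_ge _
    -- the case of one new leaf in the place of `x`
    have hone : ∀ a' b' y, Y = [y] → Region (T.expand x Y) red z pre [a', b'] post →
        active L [a, b] = active L [a', b'] + (Y.filter fun v => decide (v ∈ L)).length →
        ∃ r', HasRate D (T.expand x Y) L red r' ∧
          r' * weight k (T.expand x Y) L ≤ rate (active L [a, b]) * weight k T L := by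
      intro a' b' y hY hR hact
      refine ⟨_, .focus (h.expand hR), ?_⟩
      have h1 : (Y.filter fun v => decide (v ∈ L)).length ≤ 1 := by
        refine (List.length_filter_le _ _).trans ?_
        simp [hY]
      have h0 : (0 : ℝ) ≤ rate (active L [a', b']) := le_trans (by norm_num) (rate_ge _)
      refine (mul_le_mul_of_nonneg_left hw h0).trans ?_
      rw [hact, ← mul_assoc]
      refine mul_le_mul_of_nonneg_right ?_ hpos.le
      have hj : Y.length - 1 = 0 := by simp [hY]
      rw [hj, pow_zero, one_mul]
      rcases Nat.le_one_iff_eq_zero_or_eq_one.1 h1 with e | e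
      · rw [e]
        simp
      · rw [e, pow_one]
        exact rate_mul_le _
    have hYpos := List.length_pos_iff.2 hx.ne_nil
    have hxL := hx.not_mem_left
    by_cases hxa : x = a
    · subst hxa
      by_cases hY : Y.length = 1
      · obtain ⟨y, rfl⟩ := List.length_eq_one_iff.1 hY
        refine hone y b y rfl ?_ ?_
        · simpa using Region.expand_mid (F₁ := []) (F₂ := [b]) h.region hT hx (hxr z)
        · by_cases hy : y ∈ L <;> by_cases hb : b ∈ L <;> simp [active, hxL, hy, hb]
      · exact hbig (by omega)
    · by_cases hxb : x = b
      · subst hxb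
        by_cases hY : Y.length = 1
        · obtain ⟨y, rfl⟩ := List.length_eq_one_iff.1 hY
          refine hone a y y rfl ?_ ?_
          · simpa using Region.expand_mid (F₁ := [a]) (F₂ := []) h.region hT hx (hxr z)
          · by_cases hy : y ∈ L <;> by_cases ha : a ∈ L <;> simp [active, hxL, hy, ha]
        · exact hbig (by omega)
      · have hxp : x ∈ post := by simpa [hnil, hxa, hxb] using hxl
        obtain ⟨P₁, P₂, rfl⟩ := List.append_of_mem hxp
        exact ⟨_, .focus (h.expand (h.region.expand_post hT hx (hxr z))),
          mul_le_mul_of_nonneg_left hle hr⟩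

/-- Everything that a sequence of expansions preserves. -/
theorem expands_induction {D : Digraph (Fin n)} {T T₁ : OutTree n} {L : List (Fin n)}
    (h : Relation.ReflTransGen (Expands D L) T T₁) (hT : T.IsOutTree D) :
    T₁.IsOutTree D ∧ T₁.root = T.root ∧ T.verts ⊆ T₁.verts ∧ T.arcs.length ≤ T₁.arcs.length ∧
      (Spans D T L → Spans D T₁ L) ∧
      (∀ red, RedInactive T L red → RedInactive T₁ L red) ∧
      ∀ (k : ℕ) (red : RedList n) (r : ℝ), L.Nodup → RedInactive T L red → HasRate D T L red r →
        ∃ r', HasRate D T₁ L red r' ∧ r' * weight k T₁ L ≤ r * weight k T L := by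
  induction h with
  | refl => exact ⟨hT, rfl, List.Subset.refl _, le_rfl, id, fun _ h => h,
      fun k red r _ _ h => ⟨r, h, le_rfl⟩⟩
  | tail _ hbc ih =>
    obtain ⟨x, Y, hx, rfl⟩ := hbc
    obtain ⟨h₁, h₂, h₃, h₄, h₅, h₆, h₇⟩ := ih
    refine ⟨hx.isOutTree h₁, h₂, fun v hv => mem_verts_expand.2 (Or.inr (h₃ hv)),
      h₄.trans (length_arcs_expand hx.ne_nil).le, fun hs => (h₅ hs).expand h₁ hx,
      fun red hred => (h₆ red hred).expand _ _, fun k red r hL hred hr => ?_⟩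
    obtain ⟨r', hr', hw⟩ := h₇ k red r hL hred hr
    obtain ⟨r'', hr'', hw'⟩ := hr'.expand k h₁ hL (h₆ red hred) hx
    exact ⟨r'', hr'', hw'.trans hw⟩

/-! ### The recursion -/

theorem OutTree.Region.cons_red {T : OutTree n} {red : RedList n} {x z : Fin n}
    {pre F post : List (Fin n)} (h : Region T red z pre F post) (H : List (Fin n × Fin n))
    (hx : x = z ∨ ∀ v, (x, v) ∉ T.arcs) : Region T ((x, H) :: red) z pre F post where
  mem := h.mem
  leaves_eq := h.leaves_eq
  desc_iff := h.desc_iff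
  not_red w hw hwz ha r hr := by
    rcases List.mem_cons.1 hr with rfl | hr
    · rintro rfl
      obtain ⟨v, hv⟩ := ha
      exact (hx.resolve_left hwz) v hv
    · exact h.not_red w hw hwz ha r hr

/-- The second recursive call lowers the measure. -/
theorem exists_hasRate_grown (k : ℕ) {D : Digraph (Fin n)} {T T₂ : OutTree n}
    {L Q pre post : List (Fin n)} {red : RedList n} {x : Fin n} {H : List (Fin n × Fin n)}
    (hT : T.IsOutTree D) (hL : L.Nodup) (hl : T.leaves = pre ++ x :: post) (hpre : pre ⊆ L)
    (hH : ∀ u v, (u, v) ∈ H ↔ HatArc D T L u v) (hx : Spans D T (x :: L))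
    (hTT : Relation.ReflTransGen (Expands D L) T T₂) (hR : Region T₂ red x pre Q post)
    (hQ : Q.Nodup) (hQT : ∀ q ∈ Q, q ∉ T.verts) (hadj : ∀ v, D.Adj x v → v ∈ T₂.verts)
    (hQ2 : 2 ≤ Q.length) :
    ∃ r', HasRate D T₂ L ((x, H) :: red) r' ∧
      r' * weight k T₂ L ≤ 125 / 241 * (23 / 25) * weight k T L := by
  obtain ⟨hT₂, hroot, hsub, -⟩ := expands_induction hTT hT
  have hpos := weight_pos k T L
  have hQT₂ : Q ⊆ T₂.verts := fun q hq => hT₂.leaf_mem (by simp [hR.leaves_eq, hq])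
  have hw : weight k T₂ L ≤ (125 / 241) ^ (Q.length - 1) *
      (5 / 6) ^ (Q.filter fun v => decide (v ∈ L)).length * weight k T L := by
    refine weight_le_of_leaves k ?_ (outside_add_le hL hQ hsub hQT hQT₂)
    rw [hR.leaves_eq, hl]
    simp only [List.length_append, List.length_cons]
    omega
  by_cases h2 : Q.length = 2
  · obtain ⟨a, b, rfl⟩ := List.length_eq_two.1 h2
    -- Colouring `x` creates the focus. No arc of `D̂(T, L)` leaves `L`, and `hx`, the outcome of
    -- Step 2, gives reachability without arcs out of `x`.
    have hf : FocusAt D T₂ L ((x, H) :: red) x H pre [a, b] post := by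
      refine ⟨hR.cons_red H (Or.inl rfl), hpre, by simp, hadj,
        fun u v huv hu => absurd hu ((hH u v).1 huv).2.1, fun v => ?_⟩
      rw [hroot]
      refine Relation.ReflTransGen.mono (fun u w huw => ?_) _ _ (hx v)
      have hu := huw.2.1
      rw [List.mem_cons, not_or] at hu
      exact ⟨(hH u w).2 ⟨huw.1, hu.2, huw.2.2⟩, hu.1⟩
    refine ⟨_, .focus hf, ?_⟩
    have h0 : (0 : ℝ) ≤ rate (active L [a, b]) := le_trans (by norm_num) (rate_ge _)
    refine (mul_le_mul_of_nonneg_left hw h0).trans ?_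
    rw [← mul_assoc]
    refine mul_le_mul_of_nonneg_right ?_ hpos.le
    -- With two, one or no active leaves the factor besides `125 / 241` is `23 / 25`, `5 / 6 * (17 /
    -- 20)` or `(5 / 6) ^ 2`, so the first case is the worst.
    by_cases ha : a ∈ L <;> by_cases hb : b ∈ L <;> norm_num [active, ha, hb, rate]
  · refine ⟨1, .one, ?_⟩
    rw [one_mul]
    refine hw.trans (mul_le_mul_of_nonneg_right ?_ hpos.le)
    calc (125 / 241 : ℝ) ^ (Q.length - 1) * (5 / 6) ^ _ ≤ (125 / 241) ^ 2 * 1 := by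
          refine mul_le_mul ?_ (pow_le_one₀ (by norm_num) (by norm_num)) (by positivity)
            (by positivity)
          exact pow_le_pow_of_le_one (by norm_num) (by norm_num) (by omega)
      _ ≤ _ := by norm_num

/-- The first recursive call lowers the measure, by enough to pay for the second one. -/
theorem exists_hasRate_newLeaves (k : ℕ) {D : Digraph (Fin n)} {T : OutTree n}
    {L L' l₁ l₂ : List (Fin n)} {red : RedList n} {x : Fin n} {H : List (Fin n × Fin n)} {r : ℝ}
    (hT : T.IsOutTree D) (hl : T.leaves = l₁ ++ x :: l₂) (hl₁ : l₁ ⊆ L) (hxL : x ∉ L)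
    (hr : HasRate D T L red r)
    (hL' : L' = x :: L ∨ ∃ p, p ∉ x :: L ∧ L' = p :: x :: L)
    (hfoc : ∀ a b z H pre post, FocusAt D T L red z H pre [a, b] post →
      (x = a ∧ b ∈ L ∨ x = b ∧ a ∈ L) → ∃ p, p ∉ x :: L ∧ L' = p :: x :: L) :
    ∃ r', HasRate D T L' ((x, H) :: red) r' ∧ r' * weight k T L' ≤
      (r - 125 / 241 * (23 / 25) - 1 / 1000) * weight k T L := by
  have hx : x ∈ T.leaves := by simp [hl]
  have hpos := weight_pos k T L
  have hcons := weight_cons_eq k L (hT.leaf_mem hx)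
  -- Two new elements of `L`, one possibly outside `T`: the factor `(125 / 241) ^ 2 * (6 / 5)` is
  -- about 0.323, while at least about 0.372 is available. The focus may therefore be dropped.
  have hspecial : 17 / 20 ≤ r → (∃ p, p ∉ x :: L ∧ L' = p :: x :: L) →
      ∃ r', HasRate D T L' ((x, H) :: red) r' ∧ r' * weight k T L' ≤
        (r - 125 / 241 * (23 / 25) - 1 / 1000) * weight k T L := by
    rintro hr ⟨p, -, rfl⟩
    refine ⟨1, .one, ?_⟩
    rw [one_mul]
    refine (weight_cons_le k T p (x :: L)).trans ?_
    rw [hcons, ← mul_assoc]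
    refine mul_le_mul_of_nonneg_right ?_ hpos.le
    linarith
  have hplain : ∀ r₁, HasRate D T (x :: L) ((x, H) :: red) r₁ →
      125 / 241 * r₁ ≤ r - 125 / 241 * (23 / 25) - 1 / 1000 → L' = x :: L →
      ∃ r', HasRate D T L' ((x, H) :: red) r' ∧ r' * weight k T L' ≤
        (r - 125 / 241 * (23 / 25) - 1 / 1000) * weight k T L := by
    rintro r₁ hr₁ hle rfl
    refine ⟨r₁, hr₁, ?_⟩
    rw [hcons]
    nlinarith
  cases hr with
  | one =>
    rcases hL' with hL' | hL'
    · exact hplain 1 .one (by norm_num) hL'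
    · exact hspecial (by norm_num) hL'
  | @focus z H' pre post a b h =>
    rcases hL' with hL' | hL'
    swap
    · exact hspecial (rate_ge _) hL'
    -- Only one vertex was added, so the pair did not have exactly one active leaf when `x` was
    -- chosen from it.
    have hno : ¬ (x = a ∧ b ∈ L ∨ x = b ∧ a ∈ L) := fun hab => by
      obtain ⟨p, -, hp⟩ := hfoc a b z H' pre post h hab
      have := congrArg List.length (hL'.symm.trans hp)
      simp at this
    -- Both descriptions of the leaf list determine its first element outside `L`. This identifies
    -- `x` with the first active leaf of the pair, if there is one.
    have hfind : ∀ (l₁ l₂ : List (Fin n)) (x : Fin n), l₁ ⊆ L → x ∉ L →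
        (l₁ ++ x :: l₂).find? (fun v => decide (v ∉ L)) = some x := by
      intro l₁ l₂ x h₁ hx
      rw [List.find?_eq_some_iff_append]
      exact ⟨by simpa using hx, l₁, l₂, rfl, fun v hv => by simpa using h₁ hv⟩
    have hfx := hfind l₁ l₂ x hl₁ hxL
    have hle := h.region.leaves_eq
    rw [← hl, hle] at hfx
    by_cases ha : a ∈ L
    · by_cases hb : b ∈ L
      · have : active L [a, b] = 0 := by simp [active, ha, hb]
        rw [this] at hplain ⊢
        exact hplain 1 .one (by norm_num [rate]) hL'
      · have := hfind (pre ++ [a]) post b (by simpa [ha] using h.pre_subset) hb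
        rw [show pre ++ [a] ++ b :: post = pre ++ [a, b] ++ post by simp, hfx] at this
        exact absurd (Or.inr ⟨Option.some.inj this, ha⟩) hno
    · have := hfind pre (b :: post) a h.pre_subset ha
      rw [show pre ++ a :: b :: post = pre ++ [a, b] ++ post by simp, hfx] at this
      obtain rfl := Option.some.inj this
      have hb : b ∉ L := fun hb => hno (Or.inl ⟨rfl, hb⟩)
      have hxb : b ≠ x := by
        rintro rfl
        have := hT.leaves_nodup
        rw [hle, List.nodup_append', List.nodup_append'] at this
        simp at this
      have h2 : active L [x, b] = 2 := by simp [active, ha, hb]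
      have h1 : active (x :: L) [x, b] = 1 := by simp [active, hb, hxb]
      rw [h2] at hplain ⊢
      -- The tightest case: the pair keeps its focus with one active leaf left, and `125 / 241 * (17
      -- / 20 + 23 / 25) + 1 / 1000 ≤ 23 / 25`. The new element `x` of `L` may have out-arcs in
      -- `H_z`, but it lies in `T_z`.
      refine hplain _ (.focus (z := z) (H := H') (pre := pre) (post := post) (a := x) (b := b)
        ⟨h.region.cons_red H (Or.inr fun v => hT.leaf_not_tail hx),
          fun v hv => List.mem_cons_of_mem _ (h.pre_subset hv), ?_, h.adj_mem,
          fun u v huv hu => ?_, h.reach⟩) (by rw [h1]; norm_num [rate]) hL'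
      · rw [List.find?_cons, decide_eq_false (h.ne_of_mem hT hx)]
        exact h.find_red
      · rcases List.mem_cons.1 hu with rfl | hu
        · exact (h.region.desc_iff u hx).2 (by simp)
        · exact h.tail u v huv hu

/-! ### Step bounds and the induction over recursive calls. -/

/-- The bound on the number of steps of a call of measure `X`. -/
noncomputable def stepBound (n : ℕ) (X : ℝ) : ℕ := ⌊((n + 10 : ℕ) : ℝ) ^ 10 * (1 + 2000 * X)⌋₊

theorem stepBound_mono {X Y : ℝ} (h : X ≤ Y) : stepBound n X ≤ stepBound n Y := by
  refine Nat.floor_le_floor ?_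
  gcongr

theorem pow_le_stepBound {X : ℝ} (hX : 0 ≤ X) : (n + 10) ^ 10 ≤ stepBound n X := by
  refine Nat.le_floor ?_
  rw [Nat.cast_pow]
  exact le_mul_of_one_le_right (by positivity) (by linarith)

/-- In units of `(n + 10) ^ 10`, the local work and the constants 1 of the two calls make 3, of
which the bound itself has 1. The other 2 are `2000 * (1 / 1000)`. -/
theorem add_stepBound_le {X₁ X₂ X : ℝ} (h₁ : 0 ≤ X₁) (h₂ : 0 ≤ X₂) (h : X₁ + X₂ + 1 / 1000 ≤ X) :
    (n + 10) ^ 10 + (stepBound n X₁ + stepBound n X₂) ≤ stepBound n X := by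
  refine Nat.le_floor ?_
  push_cast
  have e₁ : (stepBound n X₁ : ℝ) ≤ _ := Nat.floor_le (by positivity)
  have e₂ : (stepBound n X₂ : ℝ) ≤ _ := Nat.floor_le (by positivity)
  have hK : (0 : ℝ) < ((n + 10 : ℕ) : ℝ) ^ 10 := by positivity
  push_cast at e₁ e₂ hK
  nlinarith

/-- Both recursive calls increase `L.length + T.arcs.length`, which stays below `2 * n`. This bounds
the depth and, with one red vertex per call, the length of `red`. Starting from `4 * n + 5` leaves
depth at least `2 * n + 1` for the subroutines. -/
theorem algB_haltsIn {D : Digraph (Fin n)} [DecidableRel D.Adj] (k : ℕ) {N : ℕ} {T : OutTree n}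
    {L : List (Fin n)} {red : RedList n} {r : ℝ} (hT : T.IsOutTree D) (hL : L.Nodup)
    (hred : RedInactive T L red) (hlen : red.length ≤ L.length + T.arcs.length)
    (hredH : ∀ r ∈ red, r.2.length ≤ n ^ 2) (hN : 4 * n + 5 ≤ N + L.length + T.arcs.length)
    (hr : HasRate D T L red r) :
    HaltsIn (algB D k N T L red) (stepBound n (r * weight k T L)) fun _ => True := by
  induction N generalizing T L red r with
  | zero =>
    have := hT.length_arcs_lt
    have := hL.length_le_fin
    omega
  | succ N ih =>
    have hLn := hL.length_le_fin
    have hAn := hT.length_arcs_lt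
    have hnN : 2 * n + 1 ≤ N := by omega
    have hr0 : 0 ≤ r := by
      cases hr with
      | one => exact zero_le_one
      | focus h => exact le_trans (by norm_num) (rate_ge _)
    have hX : 0 ≤ r * weight k T L := mul_nonneg hr0 (weight_pos k T L).le
    have hK := pow_le_stepBound (n := n) hX
    -- the local work is at most `(n + 10) ^ 10`
    have hloc : 1 + ((n + 10) ^ 6 + ((n + 10) ^ 9 + ((n + 1) + ((n + 1) + ((n * (n + 1 + 1) + 1) +
        ((n + 10) ^ 4 + ((n + 10) ^ 8 + ((n + 10) ^ 6 + 3)))))))) ≤ (n + 10) ^ 10 := by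
      ring_nf
      omega
    set B := stepBound n (r * weight k T L) with hB
    -- The number `m` is the budget left for growing `T^root(x)` and for the recursive calls once
    -- the earlier steps are paid.
    obtain ⟨m, hm⟩ : ∃ m, B = (m + ((n + 10) ^ 4 + ((n + 10) ^ 8)) + (n * (n + 1 + 1) + 1) + (n + 1) +
        (n + 1) + (n + 10) ^ 9) + (n + 10) ^ 6 + 1 := ⟨B - (((n + 10) ^ 4 + ((n + 10) ^ 8)) +
        (n * (n + 1 + 1) + 1) + (n + 1) + (n + 1) + (n + 10) ^ 9 + (n + 10) ^ 6 + 1), by omega⟩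
    rw [hm]
    refine HaltsIn.tick_bind (((hasBranchingP_haltsIn hT hL (by omega)).bind
      (d := m + ((n + 10) ^ 4 + ((n + 10) ^ 8)) + (n * (n + 1 + 1) + 1) + (n + 1) +
        (n + 1) + (n + 10) ^ 9) fun b hb => ?_).le (by omega))
    cases b
    · exact HaltsIn.pure trivial
    have hs : Spans D T L := hb.1 rfl
    refine (((forceP_haltsIn hL hT hs (N := N) (by omega)).le (d := (n + 10) ^ 9) ?_).bind
      (d := m + ((n + 10) ^ 4 + ((n + 10) ^ 8)) + (n * (n + 1 + 1) + 1) + (n + 1) +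
        (n + 1)) fun T₁ hT₁ => ?_).le (by omega)
    · calc (n - T.arcs.length) * (n + 10) ^ 8 ≤ (n + 10) * (n + 10) ^ 8 :=
          Nat.mul_le_mul_right _ (by omega)
        _ = (n + 10) ^ 9 := by ring
    obtain ⟨hTT₁, hforce⟩ := hT₁
    obtain ⟨hT₁, -, -, hA₁, hs₁, hred₁, hrate⟩ := expands_induction hTT₁ hT
    replace hs₁ := hs₁ hs
    replace hred₁ := hred₁ red hred
    obtain ⟨r₁, hr₁, hw₁⟩ := hrate k red r hL hred hr
    have hAn₁ := hT₁.length_arcs_lt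
    refine (((lengthGeP_haltsIn k L).le (d := n + 1) (by omega)).bind
      (d := m + ((n + 10) ^ 4 + ((n + 10) ^ 8)) + (n * (n + 1 + 1) + 1) + (n + 1))
        fun c₁ hc₁ => ?_).le (by omega)
    cases c₁
    swap
    · exact HaltsIn.pure trivial
    refine (((lengthGeP_haltsIn k T₁.leaves).le (d := n + 1)
      (by have := hT₁.length_leaves_le; omega)).bind
      (d := m + ((n + 10) ^ 4 + ((n + 10) ^ 8)) + (n * (n + 1 + 1) + 1)) fun c₂ hc₂ => ?_).le (by omega)
    cases c₂
    swap
    · exact HaltsIn.pure trivial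
    refine (((findP_haltsIn (q := fun v => v ∉ L) (c := n + 1) T₁.leaves fun v _ => ?_).of_length_le
      hT₁.length_leaves_le).bind (d := m + ((n + 10) ^ 4 + ((n + 10) ^ 8)))
        fun o ho => ?_).le (by omega)
    · refine ((memP_haltsIn v L).bind (d := 0) fun b hb => HaltsIn.pure ?_).le (by omega)
      simp [← hb]
    rcases ho with ⟨rfl, -⟩ | ⟨x, l₁, l₂, rfl, hl, hxL, hl₁⟩
    · exact HaltsIn.pure trivial
    replace hl₁ : l₁ ⊆ L := fun v hv => by simpa using hl₁ v hv
    have hx : x ∈ T₁.leaves := by simp [hl]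
    refine ((hatP_haltsIn hT₁ hL).bind (d := m + (n + 10) ^ 8) fun H hH => ?_).le (by omega)
    refine ((newLeavesP_haltsIn hT₁ hs₁ hL (by omega) (by omega) hredH hH.1 hH.2.1 hH.2.2 hx
      hxL).bind (d := m) fun L' hL' => ?_).le (by omega)
    obtain ⟨r₂, hr₂, hw₂⟩ := exists_hasRate_newLeaves k hT₁ hl hl₁ hxL hr₁ hL'.1 hL'.2
    have hL'n : L'.Nodup ∧ x :: L ⊆ L' ∧ L.length + 1 ≤ L'.length := by
      have hxn : (x :: L).Nodup := List.nodup_cons.2 ⟨hxL, hL⟩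
      rcases hL'.1 with rfl | ⟨p, hp, rfl⟩
      · exact ⟨hxn, List.Subset.refl _, by simp⟩
      · exact ⟨List.nodup_cons.2 ⟨hp, hxn⟩, List.subset_cons_self _ _, by simp⟩
    have hredH' : ∀ r ∈ (x, H) :: red, r.2.length ≤ n ^ 2 := by
      intro r hr
      rcases List.mem_cons.1 hr with rfl | hr
      · exact hH.2.1
      · exact hredH r hr
    -- The two tests of Step 3 have failed.
    have hw1 : 1 ≤ weight k T₁ L := one_le_weight (by
      have e₁ : ¬ k ≤ L.length := fun h => by simpa using hc₁.2 h
      have e₂ : ¬ k ≤ T₁.leaves.length := fun h => by simpa using hc₂.2 h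
      omega)
    set X₁ := (r₁ - 125 / 241 * (23 / 25) - 1 / 1000) * weight k T₁ L with hX₁
    set X₂ := 125 / 241 * (23 / 25) * weight k T₁ L with hX₂
    have hr₁0 : 17 / 20 ≤ r₁ := by
      cases hr₁ with
      | one => norm_num
      | focus h => exact rate_ge _
    have hsum : (n + 10) ^ 10 + (stepBound n X₁ + stepBound n X₂) ≤ B := by
      refine add_stepBound_le (mul_nonneg (by linarith) (by linarith))
        (mul_nonneg (by norm_num) (by linarith)) (le_trans ?_ hw₁)
      rw [hX₁, hX₂]
      linarith
    refine (((ih hT₁ hL'n.1 ?_ ?_ hredH' (by omega) hr₂).le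
      (stepBound_mono hw₂)).bind (d := (n + 10) ^ 6 + (3 + stepBound n X₂)) fun B₁ _ => ?_).le
        (by omega)
    · intro r hr
      rcases List.mem_cons.1 hr with rfl | hr
      · exact Or.inl (hL'n.2.1 List.mem_cons_self)
      · exact (hred₁ r hr).imp_left fun h => hL'n.2.1 (List.mem_cons_of_mem _ h)
    · simp only [List.length_cons]
      omega
    refine ((growTreeP_haltsIn hL hT₁ (by omega) (Region.of_leaf hT₁ red hl) hred₁
      (Or.inl rfl)).le (d := (n + 10) ^ 6) ?_).bind fun g hg => ?_
    · calc (n - T₁.arcs.length) * (n + 10) ^ 5 ≤ (n + 10) * (n + 10) ^ 5 :=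
          Nat.mul_le_mul_right _ (by omega)
        _ = (n + 10) ^ 6 := by ring
    obtain ⟨T₂, Q⟩ := g
    dsimp only at hg
    refine ((lengthGeP_haltsIn 2 Q).le (d := 3) (by omega)).bind fun c₃ hc₃ => ?_
    cases c₃
    · exact HaltsIn.pure trivial
    obtain ⟨hTT₂, hR, hQ, hQT, hadj, hA₂⟩ := hg (hc₃.1 rfl)
    obtain ⟨hT₂, -, -, -, -, hred₂, -⟩ := expands_induction hTT₂ hT₁
    obtain ⟨r₃, hr₃, hw₃⟩ := exists_hasRate_grown k hT₁ hL hl hl₁ hH.2.2 (hforce x hx hxL) hTT₂ hR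
      hQ hQT hadj (hc₃.1 rfl)
    refine (((ih hT₂ hL ?_ ?_ hredH' ?_ hr₃).le (stepBound_mono hw₃)).bind (d := 0) fun B₂ _ =>
      HaltsIn.pure trivial)
    · intro r hr
      rcases List.mem_cons.1 hr with rfl | hr
      -- The vertex `x` is internal in `T₂`: as a leaf it would belong to `Q`, whose elements are
      -- not in `T₁`.
      · by_contra! hno
        have hx₂ : x ∈ T₂.leaves := (hT₂.mem_leaves x).2
          ⟨hR.mem, fun a ha hax => hno.2 a.2 (hax ▸ ha)⟩
        have hxQ : x ∈ Q := by
          rw [← hR.desc_iff x hx₂]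
          exact .refl
        exact hQT x hxQ (hT₁.leaf_mem hx)
      · exact hred₂ red hred₁ r hr
    · simp only [List.length_cons]
      omega
    · omega

/-! ### All roots and the final constants. -/

theorem rootsP_haltsIn {D : Digraph (Fin n)} [DecidableRel D.Adj] (k : ℕ) {N c : ℕ}
    (l : List (Fin n))
    (h : ∀ x, HaltsIn (algB D k N (OutTree.single x) [] []) c fun _ => True) :
    HaltsIn (rootsP D k N l) (l.length * (c + 1) + 1) fun _ => True := by
  induction l with
  | nil => exact HaltsIn.tick_bind (HaltsIn.pure trivial)
  | cons x l ih =>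
    refine (HaltsIn.tick_bind ((h x).bind fun b _ => ih.bind (d := 0) fun c _ =>
      HaltsIn.pure trivial)).le ?_
    simp only [List.length_cons]
    ring_nf
    omega

theorem OutTree.isOutTree_single (D : Digraph (Fin n)) (x : Fin n) :
    (OutTree.single x).IsOutTree D := by
  refine ⟨by simp [single], by simp [single], by simp [single, verts], fun v hv => ?_,
    by simp [single], fun v => by simp [single, verts]⟩
  have : v = x := by simpa [single, verts] using hv
  exact this ▸ .refl

theorem exists_run_le {α : Type} {f : ℕ → Prog α} {N c : ℕ} {Q : α → Prop} {b : ℝ}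
    (h : HaltsIn (f N) c Q) (hb : (c : ℝ) ≤ b) :
    ∃ (N : ℕ) (a : α) (t : ℕ), (f N).run 0 = some (a, t) ∧ (t : ℝ) ≤ b := by
  obtain ⟨a, t, hat, ht, -⟩ := h 0
  refine ⟨N, a, t, hat, le_trans ?_ hb⟩
  exact_mod_cast (by omega : t ≤ c)

theorem stepBound_le (hn : 1 ≤ n) {k : ℕ} {X : ℝ} (hX : 0 ≤ X) (h : X ≤ 3.72 ^ k) :
    (stepBound n X : ℝ) ≤ 2001 * 11 ^ 10 * 3.72 ^ k * n ^ 10 := by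
  have h1 : (1 : ℝ) ≤ 3.72 ^ k := one_le_pow₀ (by norm_num)
  have hn' : (1 : ℝ) ≤ n := by exact_mod_cast hn
  calc (stepBound n X : ℝ) ≤ ((n + 10 : ℕ) : ℝ) ^ 10 * (1 + 2000 * X) :=
        Nat.floor_le (by positivity)
    _ ≤ (11 * n) ^ 10 * (2001 * 3.72 ^ k) := by
        gcongr
        · push_cast
          linarith
        · linarith
    _ = _ := by
        rw [mul_pow]
        ring

end Algorithm

/-- There are constants `C` and `d` such that, on every digraph with `n` vertices and for every
parameter `k`, the call `B(D, T, L)` halts after at most `C * 3.72 ^ k * n ^ d` steps for every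
triple `(D, T, L)`, and so does the algorithm for Directed `k`-Leaf, which calls `B(D, {x}, ∅)`
for all vertices `x`. -/
theorem mainTheorem1 :
    ∃ (C : ℝ) (d : ℕ), ∀ (n k : ℕ) (D : Digraph (Fin n)) [DecidableRel D.Adj], 1 ≤ n →
      (∀ (T : OutTree n) (L : List (Fin n)), OutTree.IsTriple D T L →
        ∃ (N : ℕ) (answer : Bool) (t : ℕ), (algB D k N T L []).run 0 = some (answer, t) ∧
          (t : ℝ) ≤ C * (3.72 : ℝ) ^ k * (n : ℝ) ^ d) ∧
      (∃ (N : ℕ) (answer : Bool) (t : ℕ), (directedKLeaf D k N).run 0 = some (answer, t) ∧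
          (t : ℝ) ≤ C * (3.72 : ℝ) ^ k * (n : ℝ) ^ d) := by
  -- One call takes at most `A = 2001 * 11 ^ 10 * 3.72 ^ k * n ^ 10` steps, since `n + 10 ≤ 11 * n`
  -- and `1 + 2000 * X ≤ 2001 * 3.72 ^ k`. Trying all roots takes at most `n * (A + 1) + 2 ≤ 4 * n *
  -- A`, hence the factor 4 and the exponent 11.
  refine ⟨4 * (2001 * 11 ^ 10), 11, fun n k D _ hn => ?_⟩
  have hn' : (1 : ℝ) ≤ n := by exact_mod_cast hn
  have hB : ∀ (T : OutTree n) (L : List (Fin n)), OutTree.IsTriple D T L →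
      HaltsIn (algB D k (4 * n + 5) T L []) (stepBound n (1 * weight k T L)) fun _ => True :=
    fun T L h => algB_haltsIn k h.outTree h.nodup (by simp [RedInactive]) (by simp) (by simp)
      (by omega) .one
  have hS : ∀ (T : OutTree n) (L : List (Fin n)),
      (stepBound n (1 * weight k T L) : ℝ) ≤ 2001 * 11 ^ 10 * 3.72 ^ k * n ^ 10 := fun T L => by
    rw [one_mul]
    exact stepBound_le hn (weight_pos k T L).le (weight_le k T L)
  have hA : (1 : ℝ) ≤ 2001 * 11 ^ 10 * 3.72 ^ k * n ^ 10 := by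
    have h₁ : (1 : ℝ) ≤ 3.72 ^ k := one_le_pow₀ (by norm_num)
    have h₂ : (1 : ℝ) ≤ n ^ 10 := one_le_pow₀ hn'
    exact one_le_mul_of_one_le_of_one_le
      (one_le_mul_of_one_le_of_one_le (by norm_num) h₁) h₂
  refine ⟨fun T L h => exists_run_le (hB T L h) ((hS T L).trans ?_), ?_⟩
  · rw [pow_succ]
    nlinarith
  · have hx : ∀ x : Fin n, HaltsIn (algB D k (4 * n + 5) (OutTree.single x) [] [])
        ⌊(2001 * 11 ^ 10 * 3.72 ^ k * n ^ 10 : ℝ)⌋₊ fun _ => True := fun x =>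
      (hB _ _ ⟨OutTree.isOutTree_single D x, List.nodup_nil, by simp⟩).le
        (Nat.le_floor (hS _ _))
    refine exists_run_le (f := fun N => directedKLeaf D k N)
      (HaltsIn.tick_bind (rootsP_haltsIn k (List.finRange n) hx)) ?_
    have hf := Nat.floor_le (zero_le_one.trans hA)
    set A : ℝ := 2001 * 11 ^ 10 * 3.72 ^ k * n ^ 10 with hAdef
    have hgoal : (4 * (2001 * 11 ^ 10) * 3.72 ^ k * n ^ 11 : ℝ) = 4 * (n * A) := by
      rw [hAdef]
      ring
    rw [hgoal, List.length_finRange]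
    push_cast
    have h₁ := mul_le_mul_of_nonneg_left hf (zero_le_one.trans hn')
    have h₂ := one_le_mul_of_one_le_of_one_le hn' hA
    have h₃ := le_mul_of_one_le_right (zero_le_one.trans hn') hA
    linarith
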